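/- Let $\mathsf E$ be a symmetric monoidal category and let $\mathcal C$ be a symmetric monoidal $\mathsf E$-enriched category: an $\mathsf E$-enriched category with an $\mathsf E$-enriched bifunctor $\otimes:\mathcal C\otimes\mathcal C\to\mathcal C$ and a unit object such that the underlying ordinary category $\mathrm{cat}(\mathcal C)$ is symmetric monoidal, with associators, unitors and symmetries that are $\mathsf E$-natural. By a small enriched operad $P$ we mean a coloured symmetric operad enriched in $\mathsf E$ with a small set of colours $\mathrm{Ob}(P)$ (objects $P(c_1,\dots,c_n;x)$ of $\mathsf E$ for $n\ge 0$, with symmetric group actions, units and partial compositions). A $P$-coalgebra $V$ in $\mathcal C$ is a morphism of operads from $P$ to the endomorphism operad of $\mathcal C^{\mathrm{op}}$, that is, a family of objects $(V_o)_{o\in\mathrm{Ob}(P)}$ with structure maps $$P(c_1,\dots,c_n;x)\to \mathcal C(V_x,\,V_{c_1}\otimes\cdots\otimes V_{c_n})$$ compatible with units, compositions and symmetric group actions; a morphism of coalgebras is a family of morphisms $V_o\to W_o$ of $\mathrm{cat}(\mathcal C)$ commuting with the structure maps. Let $\mathrm{Cog}(P)$ be the category of $P$-coalgebras in $\mathcal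 C$ and $U_P:\mathrm{Cog}(P)\to\mathrm{cat}(\mathcal C)^{\mathrm{Ob}(P)}$ the forgetful functor. A functor is comonadic if it has a right adjoint and its comparison functor to the category of coalgebras over the induced comonad is an equivalence. For small enriched operads $P_0,P_1$, let $P_0\otimes_{\mathbb H}P_1$ be their Hadamard tensor product, with set of colours $\mathrm{Ob}(P_0)\times\mathrm{Ob}(P_1)$ and $$(P_0\otimes_{\mathbb H}P_1)\big((c_1,c_1'),\dots,(c_n,c_n');(x,x')\big)=P_0(c_1,\dots,c_n;x)\otimes P_1(c_1',\dots,c_n';x'),$$ and let $\lozenge:\mathrm{Cog}(P_0)\times\mathrm{Cog}(P_1)\to\mathrm{Cog}(P_0\otimes_{\mathbb H}P_1)$ be the bifunctor $(V_0\lozenge V_1)_{(o,o')}=V_{0,o}\otimes V_{1,o'}$, whose structure maps are obtained by tensoring those of $V_0$ and $V_1$ and then rearranging the factors by the canonical isomorphism $(\bigotimes_i V_{0,c_i})\otimes(\bigotimes_i V_{1,c'_i})\cong\bigotimes_i(V_{0,c_i}\otimes V_{1,c'_i})$. **(a)** Let $P_0,P_1$ be small enriched operads. Suppose that $\mathrm{cat}(\mathcal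 C)$ is a closed symmetric monoidal category with small products, that $U_{P_0}$ and $U_{P_0\otimes_{\mathbb H}P_1}$ are comonadic, and that $\mathrm{Cog}(P_0)$ has coreflexive equalisers. Then for every $P_1$-coalgebra $V_1$ the functor $$\mathrm{Cog}(P_0)\to\mathrm{Cog}(P_0\otimes_{\mathbb H}P_1),\qquad V_0\mapsto V_0\lozenge V_1,$$ has a right adjoint. Likewise with the roles of $P_0$ and $P_1$ exchanged: if $\mathrm{cat}(\mathcal C)$ is closed with small products, $U_{P_1}$ and $U_{P_0\otimes_{\mathbb H}P_1}$ are comonadic, and $\mathrm{Cog}(P_1)$ has coreflexive equalisers, then for every $P_0$-coalgebra $V_0$ the functor $V_1\mapsto V_0\lozenge V_1$ has a right adjoint. **(b)** Let $f:P\to P'$ be a morphism of small enriched operads, and let $f^*:\mathrm{Cog}(P')\to\mathrm{Cog}(P)$ be restriction along $f$, so that $(f^*V)_o=V_{f(o)}$. Suppose that $\mathrm{cat}(\mathcal C)$ is complete and that $U_P$ and $U_{P'}$ are comonadic with induced comonads on $\mathrm{cat}(\mathcal C)^{\mathrm{Ob}(P)}$ and $\mathrm{cat}(\mathcal C)^{\mathrm{Ob}(P')}$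 that preserve coreflexive equalisers. Then $f^*$ has a right adjoint $f^!$. If moreover $f:\mathrm{Ob}(P)\to\mathrm{Ob}(P')$ is surjective, then $f^*$ is comonadic. -/

import Mathlib

open CategoryTheory MonoidalCategory Limits

universe w w' w'' w₃ v u₁ u₂

set_option linter.unusedSectionVars false

namespace EnrichedOperads

section EnrichedTensor

/-- The data making the `E`-enriched category `C` (with underlying symmetric monoidal category
`C`) a symmetric monoidal enriched category: the tensor product is an enriched functor
`C ⊗ C ⥤ C`, and the associator, braiding and unitor of the underlying category are enriched
natural transformations. -/
class SymmetricMonoidalEnrichedCategory (E : Type u₁) [Category.{v} E] [MonoidalCategory E]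
    [SymmetricCategory E] (C : Type u₂) [Category.{w} C] [MonoidalCategory C]
    [SymmetricCategory C] [EnrichedOrdinaryCategory E C] where
  /-- the action of the enriched functor `C ⊗ C ⥤ C` on hom objects -/
  eTensor (X₁ Y₁ X₂ Y₂ : C) :
    (X₁ ⟶[E] Y₁) ⊗ (X₂ ⟶[E] Y₂) ⟶ ((X₁ ⊗ X₂) ⟶[E] (Y₁ ⊗ Y₂))
  eTensor_id (X₁ X₂ : C) :
    (λ_ (𝟙_ E)).inv ≫ (eId E X₁ ⊗ₘ eId E X₂) ≫ eTensor X₁ X₁ X₂ X₂ = eId E (X₁ ⊗ X₂)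
  eTensor_comp (X₁ Y₁ Z₁ X₂ Y₂ Z₂ : C) :
    (eComp E X₁ Y₁ Z₁ ⊗ₘ eComp E X₂ Y₂ Z₂) ≫ eTensor X₁ Z₁ X₂ Z₂ =
      tensorμ (X₁ ⟶[E] Y₁) (Y₁ ⟶[E] Z₁) (X₂ ⟶[E] Y₂) (Y₂ ⟶[E] Z₂) ≫
        (eTensor X₁ Y₁ X₂ Y₂ ⊗ₘ eTensor Y₁ Z₁ Y₂ Z₂) ≫
          eComp E (X₁ ⊗ X₂) (Y₁ ⊗ Y₂) (Z₁ ⊗ Z₂)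
  /-- the bifunctor induced on underlying categories is the given tensor product -/
  eTensor_homEquiv {X₁ Y₁ X₂ Y₂ : C} (f : X₁ ⟶ Y₁) (g : X₂ ⟶ Y₂) :
    (λ_ (𝟙_ E)).inv ≫ (eHomEquiv E f ⊗ₘ eHomEquiv E g) ≫ eTensor X₁ Y₁ X₂ Y₂ =
      eHomEquiv E (f ⊗ₘ g)
  associator_natural (X₁ Y₁ X₂ Y₂ X₃ Y₃ : C) :
    eTensor X₁ Y₁ X₂ Y₂ ▷ (X₃ ⟶[E] Y₃) ≫ eTensor (X₁ ⊗ X₂) (Y₁ ⊗ Y₂) X₃ Y₃ ≫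
        eHomWhiskerLeft E ((X₁ ⊗ X₂) ⊗ X₃) (α_ Y₁ Y₂ Y₃).hom =
      (α_ _ _ _).hom ≫ (X₁ ⟶[E] Y₁) ◁ eTensor X₂ Y₂ X₃ Y₃ ≫
        eTensor X₁ Y₁ (X₂ ⊗ X₃) (Y₂ ⊗ Y₃) ≫
          eHomWhiskerRight E (α_ X₁ X₂ X₃).hom (Y₁ ⊗ Y₂ ⊗ Y₃)
  braiding_natural (X₁ Y₁ X₂ Y₂ : C) :
    eTensor X₁ Y₁ X₂ Y₂ ≫ eHomWhiskerLeft E (X₁ ⊗ X₂) (β_ Y₁ Y₂).hom =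
      (β_ _ _).hom ≫ eTensor X₂ Y₂ X₁ Y₁ ≫
        eHomWhiskerRight E (β_ X₁ X₂).hom (Y₂ ⊗ Y₁)
  rightUnitor_natural (X Y : C) :
    (ρ_ (X ⟶[E] Y)).inv ≫ (X ⟶[E] Y) ◁ eId E (𝟙_ C) ≫ eTensor X Y (𝟙_ C) (𝟙_ C) ≫
        eHomWhiskerLeft E (X ⊗ 𝟙_ C) (ρ_ Y).hom =
      eHomWhiskerRight E (ρ_ X).hom Y

open SymmetricMonoidalEnrichedCategory

variable {E : Type u₁} [Category.{v} E] [MonoidalCategory E] [SymmetricCategory E]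
  {C : Type u₂} [Category.{w} C] [MonoidalCategory C] [SymmetricCategory C]
  [EnrichedOrdinaryCategory E C] [SymmetricMonoidalEnrichedCategory E C]

lemma rightUnitor_inv_tensorμ (X Y : E) :
    ((ρ_ X).inv ⊗ₘ (ρ_ Y).inv) ≫ tensorμ X (𝟙_ E) Y (𝟙_ E) =
      (ρ_ (X ⊗ Y)).inv ≫ (X ⊗ Y) ◁ (λ_ (𝟙_ E)).inv := by
  have h := rightUnitor_monoidal X Y
  have h2 : tensorμ X (𝟙_ E) Y (𝟙_ E) =
      ((ρ_ X).hom ⊗ₘ (ρ_ Y).hom) ≫ (ρ_ (X ⊗ Y)).inv ≫ (X ⊗ Y) ◁ (λ_ (𝟙_ E)).inv := by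
    rw [h]; simp
  rw [h2]; simp

lemma leftUnitor_inv_tensorμ (X Y : E) :
    ((λ_ X).inv ⊗ₘ (λ_ Y).inv) ≫ tensorμ (𝟙_ E) X (𝟙_ E) Y =
      (λ_ (X ⊗ Y)).inv ≫ (λ_ (𝟙_ E)).inv ▷ (X ⊗ Y) := by
  have h := leftUnitor_monoidal X Y
  have h2 : tensorμ (𝟙_ E) X (𝟙_ E) Y =
      ((λ_ X).hom ⊗ₘ (λ_ Y).hom) ≫ (λ_ (X ⊗ Y)).inv ≫ (λ_ (𝟙_ E)).inv ▷ (X ⊗ Y) := by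
    rw [h]; simp
  rw [h2]; simp

lemma eTensor_eHomWhiskerLeft (X X' : C) {Y Z Y' Z' : C} (b : Y ⟶ Z) (b' : Y' ⟶ Z') :
    (eHomWhiskerLeft E X b ⊗ₘ eHomWhiskerLeft E X' b') ≫ eTensor X Z X' Z' =
      eTensor X Y X' Y' ≫ eHomWhiskerLeft E (X ⊗ X') (b ⊗ₘ b') := by
  simp only [eHomWhiskerLeft, ← tensorHom_comp_tensorHom, Category.assoc, eTensor_comp,
    ← eTensor_homEquiv]
  rw [← id_tensorHom, ← id_tensorHom, tensorμ_natural_assoc,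
    ← Category.assoc, rightUnitor_inv_tensorμ]
  rw [id_tensorHom_id, id_tensorHom, MonoidalCategory.tensorHom_def' (eTensor X Y X' Y'),
    rightUnitor_inv_naturality_assoc]
  simp only [MonoidalCategory.whiskerLeft_comp, Category.assoc, ← whisker_exchange_assoc]

lemma eTensor_eHomWhiskerRight {X Y X' Y' : C} (b : X ⟶ Y) (b' : X' ⟶ Y') (Z Z' : C) :
    (eHomWhiskerRight E b Z ⊗ₘ eHomWhiskerRight E b' Z') ≫ eTensor X Z X' Z' =
      eTensor Y Z Y' Z' ≫ eHomWhiskerRight E (b ⊗ₘ b') (Z ⊗ Z') := by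
  simp only [eHomWhiskerRight, ← tensorHom_comp_tensorHom, Category.assoc, eTensor_comp,
    ← eTensor_homEquiv]
  rw [← tensorHom_id, ← tensorHom_id, tensorμ_natural_assoc,
    ← Category.assoc, leftUnitor_inv_tensorμ]
  rw [id_tensorHom_id, tensorHom_id, MonoidalCategory.tensorHom_def (eTensor X Y X' Y'),
    leftUnitor_inv_naturality_assoc]
  simp only [MonoidalCategory.comp_whiskerRight, Category.assoc, whisker_exchange_assoc]

/-- The external tensor product of generalised elements of hom objects. -/
def box {Z Z' : E} {X Y X' Y' : C} (u : Z ⟶ (X ⟶[E] Y)) (u' : Z' ⟶ (X' ⟶[E] Y')) :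
    Z ⊗ Z' ⟶ ((X ⊗ X') ⟶[E] (Y ⊗ Y')) :=
  (u ⊗ₘ u') ≫ eTensor X Y X' Y'

/-- Commutation of a square with sides the morphisms `a`, `b` of `C` and the
generalised elements `u`, `v` of hom objects. -/
def Sq {Z : E} {X Y X' Y' : C} (u : Z ⟶ (X ⟶[E] Y)) (v : Z ⟶ (X' ⟶[E] Y'))
    (a : X ⟶ X') (b : Y ⟶ Y') : Prop :=
  u ≫ eHomWhiskerLeft E X b = v ≫ eHomWhiskerRight E a Y'

lemma box_whiskerLeft {Z Z' : E} {X Y X' Y' W W' : C} (u : Z ⟶ (X ⟶[E] Y))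
    (u' : Z' ⟶ (X' ⟶[E] Y')) (b : Y ⟶ W) (b' : Y' ⟶ W') :
    box (u ≫ eHomWhiskerLeft E X b) (u' ≫ eHomWhiskerLeft E X' b') =
      box u u' ≫ eHomWhiskerLeft E (X ⊗ X') (b ⊗ₘ b') := by
  simp only [box, ← tensorHom_comp_tensorHom, Category.assoc, eTensor_eHomWhiskerLeft]

lemma box_whiskerRight {Z Z' : E} {X Y X' Y' W W' : C} (u : Z ⟶ (X ⟶[E] Y))
    (u' : Z' ⟶ (X' ⟶[E] Y')) (b : W ⟶ X) (b' : W' ⟶ X') :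
    box (u ≫ eHomWhiskerRight E b Y) (u' ≫ eHomWhiskerRight E b' Y') =
      box u u' ≫ eHomWhiskerRight E (b ⊗ₘ b') (Y ⊗ Y') := by
  simp only [box, ← tensorHom_comp_tensorHom, Category.assoc, eTensor_eHomWhiskerRight]

lemma box_pre {T T' Z Z' : E} {X Y X' Y' : C} (z : T ⟶ Z) (z' : T' ⟶ Z') (u : Z ⟶ (X ⟶[E] Y))
    (u' : Z' ⟶ (X' ⟶[E] Y')) : box (z ≫ u) (z' ≫ u') = (z ⊗ₘ z') ≫ box u u' := by
  simp only [box, ← tensorHom_comp_tensorHom, Category.assoc]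

namespace Sq

variable {Z Z' Z'' : E} {X Y X' Y' X'' Y'' X₁ Y₁ X₂ Y₂ X₃ Y₃ : C}

lemma refl (u : Z ⟶ (X ⟶[E] Y)) : Sq u u (𝟙 X) (𝟙 Y) := by simp [Sq]

lemma trans {u : Z ⟶ (X ⟶[E] Y)} {v : Z ⟶ (X' ⟶[E] Y')} {t : Z ⟶ (X'' ⟶[E] Y'')}
    {a : X ⟶ X'} {b : Y ⟶ Y'} {a' : X' ⟶ X''} {b' : Y' ⟶ Y''}
    (h : Sq u v a b) (h' : Sq v t a' b') : Sq u t (a ≫ a') (b ≫ b') := by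
  unfold Sq at *
  rw [eHomWhiskerLeft_comp, reassoc_of% h, ← eHom_whisker_exchange, reassoc_of% h',
    eHomWhiskerRight_comp]

lemma inv {u : Z ⟶ (X ⟶[E] Y)} {v : Z ⟶ (X' ⟶[E] Y')} {a : X ≅ X'} {b : Y ≅ Y'}
    (h : Sq u v a.hom b.hom) : Sq v u a.inv b.inv := by
  unfold Sq at *
  have h1 : v = u ≫ eHomWhiskerLeft E X b.hom ≫ eHomWhiskerRight E a.inv _ := by
    rw [reassoc_of% h, ← eHomWhiskerRight_comp]; simp
  rw [h1, Category.assoc, Category.assoc, ← eHom_whisker_exchange, ← eHomWhiskerLeft_comp_assoc]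
  simp

lemma pre {u : Z ⟶ (X ⟶[E] Y)} {v : Z ⟶ (X' ⟶[E] Y')} {a : X ⟶ X'} {b : Y ⟶ Y'}
    (h : Sq u v a b) (z : Z' ⟶ Z) : Sq (z ≫ u) (z ≫ v) a b := by
  unfold Sq at *
  simp only [Category.assoc, h]

lemma tensor {u : Z ⟶ (X ⟶[E] Y)} {v : Z ⟶ (X' ⟶[E] Y')} {a : X ⟶ X'} {b : Y ⟶ Y'}
    {u₁ : Z' ⟶ (X₁ ⟶[E] Y₁)} {v₁ : Z' ⟶ (X₂ ⟶[E] Y₂)} {a₁ : X₁ ⟶ X₂} {b₁ : Y₁ ⟶ Y₂}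
    (h : Sq u v a b) (h₁ : Sq u₁ v₁ a₁ b₁) :
    Sq (box u u₁) (box v v₁) (a ⊗ₘ a₁) (b ⊗ₘ b₁) := by
  unfold Sq at *
  rw [← box_whiskerLeft, h, h₁, box_whiskerRight]

lemma assoc (u : Z ⟶ (X₁ ⟶[E] Y₁)) (v : Z' ⟶ (X₂ ⟶[E] Y₂)) (t : Z'' ⟶ (X₃ ⟶[E] Y₃)) :
    Sq (box (box u v) t) ((α_ Z Z' Z'').hom ≫ box u (box v t)) (α_ X₁ X₂ X₃).hom
      (α_ Y₁ Y₂ Y₃).hom := by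
  have h := associator_natural (E := E) X₁ Y₁ X₂ Y₂ X₃ Y₃
  have e1 : box (box u v) t = ((u ⊗ₘ v) ⊗ₘ t) ≫ eTensor X₁ Y₁ X₂ Y₂ ▷ (X₃ ⟶[E] Y₃) ≫
      eTensor (X₁ ⊗ X₂) (Y₁ ⊗ Y₂) X₃ Y₃ := by
    simp [box, MonoidalCategory.tensorHom_def']
  have e2 : box u (box v t) = (u ⊗ₘ (v ⊗ₘ t)) ≫ (X₁ ⟶[E] Y₁) ◁ eTensor X₂ Y₂ X₃ Y₃ ≫
        eTensor X₁ Y₁ (X₂ ⊗ X₃) (Y₂ ⊗ Y₃) := by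
    simp [box, MonoidalCategory.tensorHom_def]
  unfold Sq
  rw [e1, e2]
  simp only [Category.assoc]
  rw [h, associator_naturality_assoc]

lemma braid (u : Z ⟶ (X₁ ⟶[E] Y₁)) (v : Z' ⟶ (X₂ ⟶[E] Y₂)) :
    Sq (box u v) ((β_ Z Z').hom ≫ box v u) (β_ X₁ X₂).hom (β_ Y₁ Y₂).hom := by
  unfold Sq box
  simp only [Category.assoc]
  rw [braiding_natural, BraidedCategory.braiding_naturality_assoc]

lemma middle (u : Z ⟶ (X₁ ⟶[E] Y₁)) (v : Z' ⟶ (X₂ ⟶[E] Y₂)) (t : Z'' ⟶ (X₃ ⟶[E] Y₃)) :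
    Sq (box u (box v t)) (((α_ Z Z' Z'').inv ≫ (β_ Z Z').hom ▷ Z'' ≫ (α_ Z' Z Z'').hom) ≫
      box v (box u t)) ((α_ X₁ X₂ X₃).inv ≫ (β_ X₁ X₂).hom ▷ X₃ ≫ (α_ X₂ X₁ X₃).hom)
      ((α_ Y₁ Y₂ Y₃).inv ≫ (β_ Y₁ Y₂).hom ▷ Y₃ ≫ (α_ Y₂ Y₁ Y₃).hom) := by
  have h1 := (assoc u v t).inv.pre (α_ Z Z' Z'').inv
  rw [Iso.inv_hom_id_assoc] at h1
  have h2 := ((braid u v).tensor (refl t)).pre (α_ Z Z' Z'').inv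
  have h3 := (assoc v u t).pre ((α_ Z Z' Z'').inv ≫ (β_ Z Z').hom ▷ Z'')
  rw [show box ((β_ Z Z').hom ≫ box v u) t = (β_ Z Z').hom ▷ Z'' ≫ box (box v u) t by
    simpa using box_pre (β_ Z Z').hom (𝟙 _) (box v u) t] at h2
  rw [Category.assoc] at h3
  rw [tensorHom_id, tensorHom_id] at h2
  simpa only [Category.assoc] using h1.trans (h2.trans h3)

lemma mu {Z₁ Z₂ Z₃ Z₄ : E} {X₄ Y₄ : C} (u : Z₁ ⟶ (X₁ ⟶[E] Y₁)) (v : Z₂ ⟶ (X₂ ⟶[E] Y₂))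
    (t : Z₃ ⟶ (X₃ ⟶[E] Y₃)) (s : Z₄ ⟶ (X₄ ⟶[E] Y₄)) :
    Sq (box (box u v) (box t s)) (tensorμ Z₁ Z₂ Z₃ Z₄ ≫ box (box u t) (box v s))
      (tensorμ X₁ X₂ X₃ X₄) (tensorμ Y₁ Y₂ Y₃ Y₄) := by
  have h1 := assoc u v (box t s)
  have h2 := ((refl u).tensor (middle v t s)).pre (α_ Z₁ Z₂ (Z₃ ⊗ Z₄)).hom
  have h3 := (assoc u t (box v s)).inv.pre ((α_ Z₁ Z₂ (Z₃ ⊗ Z₄)).hom ≫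
    Z₁ ◁ ((α_ Z₂ Z₃ Z₄).inv ≫ (β_ Z₂ Z₃).hom ▷ Z₄ ≫ (α_ Z₃ Z₂ Z₄).hom) ≫ (α_ Z₁ Z₃ (Z₂ ⊗ Z₄)).inv)
  have e : box u (((α_ Z₂ Z₃ Z₄).inv ≫ (β_ Z₂ Z₃).hom ▷ Z₄ ≫ (α_ Z₃ Z₂ Z₄).hom) ≫
      box t (box v s)) = Z₁ ◁ ((α_ Z₂ Z₃ Z₄).inv ≫ (β_ Z₂ Z₃).hom ▷ Z₄ ≫ (α_ Z₃ Z₂ Z₄).hom) ≫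
      box u (box t (box v s)) := by
    have := box_pre (𝟙 Z₁) ((α_ Z₂ Z₃ Z₄).inv ≫ (β_ Z₂ Z₃).hom ▷ Z₄ ≫ (α_ Z₃ Z₂ Z₄).hom) u
      (box t (box v s))
    rwa [Category.id_comp, id_tensorHom] at this
  simp only [Category.assoc] at e
  simp only [Category.assoc, e, id_tensorHom] at h2
  simp only [Category.assoc, Iso.inv_hom_id_assoc] at h1 h2 h3
  have h := h1.trans (h2.trans h3)
  simpa only [tensorμ, Category.assoc, MonoidalCategory.whiskerLeft_comp] using h

end Sq

variable (E) in
/-- The action `u ↦ u ⊗ W` of the enriched functor `- ⊗ W` on hom objects. -/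
def eWhiskerRight (X Y W : C) : (X ⟶[E] Y) ⟶ ((X ⊗ W) ⟶[E] (Y ⊗ W)) :=
  (ρ_ (X ⟶[E] Y)).inv ≫ (X ⟶[E] Y) ◁ eId E W ≫ eTensor X Y W W

variable (E) in
/-- The action `u ↦ W ⊗ u` of the enriched functor `W ⊗ -` on hom objects. -/
def eWhiskerLeft (W X Y : C) : (X ⟶[E] Y) ⟶ ((W ⊗ X) ⟶[E] (W ⊗ Y)) :=
  (λ_ (X ⟶[E] Y)).inv ≫ eId E W ▷ (X ⟶[E] Y) ≫ eTensor W W X Y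

lemma box_eId (X X' : C) : box (eId E X) (eId E X') = (λ_ (𝟙_ E)).hom ≫ eId E (X ⊗ X') := by
  rw [← eTensor_id]; simp [box]

lemma Sq.whiskerRight {Z Z' : E} {X Y X' Y' : C} (u : Z ⟶ (X ⟶[E] Y)) (u' : Z' ⟶ (X' ⟶[E] Y'))
    (W W' : C) :
    Sq (box (u ≫ eWhiskerRight E X Y W) (u' ≫ eWhiskerRight E X' Y' W'))
      (box u u' ≫ eWhiskerRight E (X ⊗ X') (Y ⊗ Y') (W ⊗ W'))
      (tensorμ X W X' W') (tensorμ Y W Y' W') := by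
  have e : ∀ {Z : E} {X Y : C} (u : Z ⟶ (X ⟶[E] Y)) (W : C), u ≫ eWhiskerRight E X Y W =
      (ρ_ Z).inv ≫ box u (eId E W) := by
    intro Z X Y u W
    simp [eWhiskerRight, box, MonoidalCategory.tensorHom_def]
  rw [e, e, e, box_pre]
  convert! (Sq.mu u (eId E W) u' (eId E W')).pre ((ρ_ Z).inv ⊗ₘ (ρ_ Z').inv) using 1
  rw [← Category.assoc, rightUnitor_inv_tensorμ, box_eId, Category.assoc]
  have h := box_pre (𝟙 _) (λ_ (𝟙_ E)).hom (box u u') (eId E (W ⊗ W'))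
  rw [Category.id_comp] at h
  rw [h, id_tensorHom, whiskerLeft_inv_hom_assoc]

lemma Sq.whiskerLeft {Z Z' : E} {X Y X' Y' : C} (u : Z ⟶ (X ⟶[E] Y)) (u' : Z' ⟶ (X' ⟶[E] Y'))
    (W W' : C) :
    Sq (box (u ≫ eWhiskerLeft E W X Y) (u' ≫ eWhiskerLeft E W' X' Y'))
      (box u u' ≫ eWhiskerLeft E (W ⊗ W') (X ⊗ X') (Y ⊗ Y'))
      (tensorμ W X W' X') (tensorμ W Y W' Y') := by
  have e : ∀ {Z : E} {X Y : C} (u : Z ⟶ (X ⟶[E] Y)) (W : C), u ≫ eWhiskerLeft E W X Y =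
      (λ_ Z).inv ≫ box (eId E W) u := by
    intro Z X Y u W
    simp [eWhiskerLeft, box, MonoidalCategory.tensorHom_def']
  rw [e, e, e, box_pre]
  convert! (Sq.mu (eId E W) u (eId E W') u').pre ((λ_ Z).inv ⊗ₘ (λ_ Z').inv) using 1
  rw [← Category.assoc, leftUnitor_inv_tensorμ, box_eId, Category.assoc]
  have h := box_pre (λ_ (𝟙_ E)).hom (𝟙 _) (eId E (W ⊗ W')) (box u u')
  rw [Category.id_comp] at h
  rw [h, tensorHom_id, inv_hom_whiskerRight_assoc]

end EnrichedTensor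

section Coherence

variable {C : Type u₂} [Category.{w} C] [MonoidalCategory C] [SymmetricCategory C]

lemma braiding_tensorμ (a b a' b' : C) :
    ((β_ a b).hom ⊗ₘ (β_ a' b').hom) ≫ tensorμ b a b' a' =
      tensorμ a b a' b' ≫ (β_ (a ⊗ a') (b ⊗ b')).hom := by
  simp [tensorμ, SymmetricCategory.braiding_swap_eq_inv_braiding b a', MonoidalCategory.tensorHom_def]

lemma tensorμ_tensorμ (a b a' b' : C) :
    tensorμ a b a' b' ≫ tensorμ a a' b b' = 𝟙 _ := by
  have : tensorμ a a' b b' = tensorδ a b a' b' := by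
    simp [tensorμ, tensorδ, SymmetricCategory.braiding_swap_eq_inv_braiding b a']
  rw [this, tensorμ_tensorδ]

lemma tensorμ_braiding (a b a' b' : C) :
    tensorμ a b a' b' ≫ ((β_ a a').hom ⊗ₘ (β_ b b').hom) =
      (β_ (a ⊗ b) (a' ⊗ b')).hom ≫ tensorμ a' b' a b := by
  have h1 := braiding_tensorμ a a' b b'
  have h3 := tensorμ_tensorμ a b a' b'
  calc _ = tensorμ a b a' b' ≫ (((β_ a a').hom ⊗ₘ (β_ b b').hom) ≫ tensorμ a' a b' b) ≫
        tensorμ a' b' a b := by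
          rw [Category.assoc, tensorμ_tensorμ, Category.comp_id]
    _ = _ := by rw [h1, Category.assoc, reassoc_of% h3]

/-- The symmetry `a ⊗ (b ⊗ t) ⟶ b ⊗ (a ⊗ t)`. -/
def swapFront (a b t : C) : a ⊗ (b ⊗ t) ⟶ b ⊗ (a ⊗ t) :=
  (α_ a b t).inv ≫ (β_ a b).hom ▷ t ≫ (α_ b a t).hom

lemma swapFront_tensorμ (a b t a' b' t' : C) :
    (swapFront a b t ⊗ₘ swapFront a' b' t') ≫ tensorμ b (a ⊗ t) b' (a' ⊗ t') ≫
        (b ⊗ b') ◁ tensorμ a t a' t' =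
      tensorμ a (b ⊗ t) a' (b' ⊗ t') ≫ (a ⊗ a') ◁ tensorμ b t b' t' ≫
        swapFront (a ⊗ a') (b ⊗ b') (t ⊗ t') := by
  have h1 := associator_monoidal b a t b' a' t'
  have h2 := associator_monoidal a b t a' b' t'
  have h3 : tensorμ a (b ⊗ t) a' (b' ⊗ t') ≫ (a ⊗ a') ◁ tensorμ b t b' t' =
      ((α_ a b t).inv ⊗ₘ (α_ a' b' t').inv) ≫ tensorμ (a ⊗ b) t (a' ⊗ b') t' ≫
        tensorμ a b a' b' ▷ (t ⊗ t') ≫ (α_ (a ⊗ a') (b ⊗ b') (t ⊗ t')).hom := by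
    rw [h2]; simp
  unfold swapFront
  rw [reassoc_of% h3, Iso.hom_inv_id_assoc, ← comp_whiskerRight_assoc, ← braiding_tensorμ,
    comp_whiskerRight_assoc]
  simp only [← tensorHom_comp_tensorHom, Category.assoc]
  have h4 := tensorμ_natural (β_ a b).hom (𝟙 t) (β_ a' b').hom (𝟙 t')
  simp only [tensorHom_id, id_whiskerRight] at h4
  rw [← h1, reassoc_of% h4]

/-- The tensor product `x₁ ⊗ (x₂ ⊗ (⋯ ⊗ (xₙ ⊗ 𝟙)))` of a list of objects. -/
def tensorList : List C → C
  | [] => 𝟙_ C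
  | a :: l => a ⊗ tensorList l

/-- The tensor product `x₁ ⊗ (x₂ ⊗ (⋯ ⊗ (xₙ ⊗ 𝟙)))` of a tuple of objects. -/
def tensorTuple : {n : ℕ} → (Fin n → C) → C
  | 0, _ => 𝟙_ C
  | _ + 1, c => c 0 ⊗ tensorTuple (fun i => c i.succ)

lemma tensorTuple_eq : {n : ℕ} → (c : Fin n → C) → tensorTuple c = tensorList (List.ofFn c)
  | 0, _ => by simp [tensorTuple, tensorList]
  | n + 1, c => by rw [List.ofFn_succ, tensorTuple, tensorList, tensorTuple_eq]

/-- Functoriality of the tensor product of a tuple of objects. -/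
def tensorTupleMap : {n : ℕ} → {c d : Fin n → C} → (∀ i, c i ⟶ d i) →
    (tensorTuple c ⟶ tensorTuple d)
  | 0, _, _, _ => 𝟙 (𝟙_ C)
  | _ + 1, _, _, f => f 0 ⊗ₘ tensorTupleMap (fun i => f i.succ)

@[simp]
lemma tensorTupleMap_id : {n : ℕ} → (c : Fin n → C) →
    tensorTupleMap (fun i => 𝟙 (c i)) = 𝟙 (tensorTuple c)
  | 0, _ => rfl
  | n + 1, c => by
    rw [tensorTupleMap, tensorTupleMap_id]
    exact id_tensorHom_id _ _

lemma tensorTupleMap_comp : {n : ℕ} → {c d e : Fin n → C} → (f : ∀ i, c i ⟶ d i) →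
    (g : ∀ i, d i ⟶ e i) →
    tensorTupleMap (fun i => f i ≫ g i) = tensorTupleMap f ≫ tensorTupleMap g
  | 0, _, _, _, _, _ => (Category.id_comp _).symm
  | n + 1, c, d, e, f, g => by
    rw [tensorTupleMap, tensorTupleMap_comp]
    exact (tensorHom_comp_tensorHom _ _ _ _).symm

/-- The canonical map `(⨂ l) ⊗ (⨂ r) ⟶ ⨂ (l ++ r)`. -/
def appendHom : (l r : List C) → (tensorList l ⊗ tensorList r ⟶ tensorList (l ++ r))
  | [], r => (λ_ (tensorList r)).hom
  | a :: l, r => (α_ a (tensorList l) (tensorList r)).hom ≫ a ◁ appendHom l r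

/-- Equal tuples have equal tensor products. -/
def tupleCast {n : ℕ} {c c' : Fin n → C} (h : ∀ i, c i = c' i) : tensorTuple c ⟶ tensorTuple c' :=
  eqToHom (congrArg tensorTuple (funext h))

/-- The symmetry isomorphism
`x₀ ⊗ ⋯ ⊗ xₙ ⟶ xᵢ ⊗ (x₀ ⊗ ⋯ ⊗ xᵢ₋₁ ⊗ xᵢ₊₁ ⊗ ⋯ ⊗ xₙ)` bringing the `i`-th factor to the front. -/
def extractHom : {n : ℕ} → (c : Fin (n + 1) → C) → (i : Fin (n + 1)) →
    (tensorTuple c ⟶ c i ⊗ tensorTuple (fun j => c (i.succAbove j)))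
  | 0, c, i => Fin.cases (motive := fun i => tensorTuple c ⟶
        c i ⊗ tensorTuple (fun j => c (i.succAbove j)))
      (c 0 ◁ tupleCast (fun _ => by simp)) (fun k => k.elim0) i
  | n + 1, c, i => Fin.cases (motive := fun i => tensorTuple c ⟶
        c i ⊗ tensorTuple (fun j => c (i.succAbove j)))
      (c 0 ◁ tupleCast (fun _ => by simp))
      (fun k => c 0 ◁ extractHom (fun j => c j.succ) k ≫
        swapFront (c 0) (c k.succ) (tensorTuple (fun j => c (k.succAbove j).succ)) ≫
        c k.succ ◁ tupleCast (c := Fin.cons (α := fun _ => C) (c 0)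
            (fun j => c (k.succAbove j).succ))
          (fun j => by induction j using Fin.cases <;> simp)) i

/-- For a permutation `σ` of `{0, …, n}`, the permutation of `{0, …, n - 1}` obtained by
removing `0` from the source and `σ 0` from the target. -/
def permTail {n : ℕ} (σ : Equiv.Perm (Fin (n + 1))) : Equiv.Perm (Fin n) :=
  (finSuccAboveEquiv 0).trans
    ((σ.subtypeEquiv (fun a => by simp)).trans (finSuccAboveEquiv (σ 0)).symm)

lemma succAbove_permTail {n : ℕ} (σ : Equiv.Perm (Fin (n + 1))) (i : Fin n) :
    (σ 0).succAbove (permTail σ i) = σ i.succ := by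
  have h := (finSuccAboveEquiv (σ 0)).apply_symm_apply
    ⟨σ i.succ, fun h => Fin.succ_ne_zero i (σ.injective h)⟩
  have h' := congrArg Subtype.val h
  rw [finSuccAboveEquiv_apply] at h'
  convert h'
  simp only [permTail, Equiv.trans_apply]
  congr 1

/-- The symmetry isomorphism `x₁ ⊗ ⋯ ⊗ xₙ ⟶ x_{σ(1)} ⊗ ⋯ ⊗ x_{σ(n)}`. -/
def permHom : {n : ℕ} → (σ : Equiv.Perm (Fin n)) → (c : Fin n → C) →
    (tensorTuple c ⟶ tensorTuple (c ∘ σ))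
  | 0, _, _ => 𝟙 (𝟙_ C)
  | _ + 1, σ, c => extractHom c (σ 0) ≫
      c (σ 0) ◁ (permHom (permTail σ) (fun j => c ((σ 0).succAbove j)) ≫
        tupleCast (c' := fun i => c (σ i.succ)) (fun i => congrArg c (succAbove_permTail σ i)))

/-- The canonical map `(⨂ c) ⊗ (⨂ d) ⟶ ⨂ (c ⊗ d)`. -/
def tupleMu : {n : ℕ} → (c d : Fin n → C) →
    (tensorTuple c ⊗ tensorTuple d ⟶ tensorTuple (fun i => c i ⊗ d i))
  | 0, _, _ => (λ_ (𝟙_ C)).hom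
  | _ + 1, c, d => tensorμ (c 0) _ (d 0) _ ≫
      (c 0 ⊗ d 0) ◁ tupleMu (fun i => c i.succ) (fun i => d i.succ)

lemma tupleMu_natural : {n : ℕ} → {c d c' d' : Fin n → C} → (f : ∀ i, c i ⟶ c' i) →
    (g : ∀ i, d i ⟶ d' i) →
    (tensorTupleMap f ⊗ₘ tensorTupleMap g) ≫ tupleMu c' d' =
      tupleMu c d ≫ tensorTupleMap (fun i => f i ⊗ₘ g i)
  | 0, _, _, _, _, _, _ => by simp [tensorTupleMap, tupleMu, tensorTuple]
  | n + 1, c, d, c', d', f, g => by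
    simp only [tensorTupleMap, tupleMu, tensorTuple]
    rw [tensorμ_natural_assoc, ← id_tensorHom, ← id_tensorHom, tensorHom_comp_tensorHom,
      tupleMu_natural, Category.assoc, tensorHom_comp_tensorHom]
    simp

lemma tupleMu_tupleCast {n : ℕ} {c d c' d' : Fin n → C} (hc : ∀ i, c i = c' i)
    (hd : ∀ i, d i = d' i) :
    (tupleCast hc ⊗ₘ tupleCast hd) ≫ tupleMu c' d' =
      tupleMu c d ≫ tupleCast (fun i => by rw [hc, hd]) := by
  obtain rfl := funext hc
  obtain rfl := funext hd
  simp [tupleCast]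

lemma whiskerLeft_tensorμ (x y : C) {A B D A' B' D' : C} (f : A ⟶ A') (g : B ⟶ B') (h : D ⟶ D')
    (m : A ⊗ B ⟶ D) (m' : A' ⊗ B' ⟶ D') (H : (f ⊗ₘ g) ≫ m' = m ≫ h) :
    (x ◁ f ⊗ₘ y ◁ g) ≫ tensorμ x A' y B' ≫ (x ⊗ y) ◁ m' =
      tensorμ x A y B ≫ (x ⊗ y) ◁ m ≫ (x ⊗ y) ◁ h := by
  have h4 := tensorμ_natural (𝟙 x) f (𝟙 y) g
  simp only [id_tensorHom, tensorHom_id, id_whiskerRight] at h4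
  rw [reassoc_of% h4, ← MonoidalCategory.whiskerLeft_comp, H, MonoidalCategory.whiskerLeft_comp]

lemma swapFront_natural (x y : C) {A B : C} (f : A ⟶ B) :
    swapFront x y A ≫ y ◁ x ◁ f = x ◁ y ◁ f ≫ swapFront x y B := by
  simp only [swapFront, Category.assoc]
  rw [← associator_naturality_right, ← whisker_exchange_assoc, associator_inv_naturality_right_assoc]

lemma extract_step {x y p q A B D R S RS R' S' RS' : C} (f : A ⟶ p ⊗ R) (g : B ⟶ q ⊗ S)
    (m : A ⊗ B ⟶ D) (e : D ⟶ (p ⊗ q) ⊗ RS) (n : R ⊗ S ⟶ RS)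
    (H : (f ⊗ₘ g) ≫ tensorμ p R q S ≫ (p ⊗ q) ◁ n = m ≫ e)
    (r : x ⊗ R ⟶ R') (s : y ⊗ S ⟶ S') (t : (x ⊗ y) ⊗ RS ⟶ RS') (n' : R' ⊗ S' ⟶ RS')
    (H' : (r ⊗ₘ s) ≫ n' = (tensorμ x R y S ≫ (x ⊗ y) ◁ n) ≫ t) :
    (x ◁ f ≫ swapFront x p R ≫ p ◁ r ⊗ₘ y ◁ g ≫ swapFront y q S ≫ q ◁ s) ≫
        tensorμ p R' q S' ≫ (p ⊗ q) ◁ n' =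
      (tensorμ x A y B ≫ (x ⊗ y) ◁ m) ≫
        (x ⊗ y) ◁ e ≫ swapFront (x ⊗ y) (p ⊗ q) RS ≫ (p ⊗ q) ◁ t := by
  have h1 := whiskerLeft_tensorμ p q r s t _ n' H'
  have h2 := swapFront_tensorμ x p R y q S
  have h3 := whiskerLeft_tensorμ x y f g e m (tensorμ p R q S ≫ (p ⊗ q) ◁ n) H
  have h4 := swapFront_natural (x ⊗ y) (p ⊗ q) n
  simp only [← tensorHom_comp_tensorHom, Category.assoc, h1, MonoidalCategory.whiskerLeft_comp]
  simp only [MonoidalCategory.whiskerLeft_comp] at h3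
  rw [reassoc_of% h2, reassoc_of% h4, reassoc_of% h3]

lemma perm_step {p q A B D R S RS R' S' RS' : C} (f : A ⟶ p ⊗ R) (g : B ⟶ q ⊗ S)
    (m : A ⊗ B ⟶ D) (e : D ⟶ (p ⊗ q) ⊗ RS) (n : R ⊗ S ⟶ RS)
    (H : (f ⊗ₘ g) ≫ tensorμ p R q S ≫ (p ⊗ q) ◁ n = m ≫ e)
    (r : R ⟶ R') (s : S ⟶ S') (t : RS ⟶ RS') (n' : R' ⊗ S' ⟶ RS')
    (H' : (r ⊗ₘ s) ≫ n' = n ≫ t) :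
    (f ≫ p ◁ r ⊗ₘ g ≫ q ◁ s) ≫ tensorμ p R' q S' ≫ (p ⊗ q) ◁ n' =
      m ≫ e ≫ (p ⊗ q) ◁ t := by
  rw [← tensorHom_comp_tensorHom, Category.assoc, whiskerLeft_tensorμ p q r s t _ n' H',
    ← reassoc_of% H]

lemma extractHom_tupleMu : {n : ℕ} → (c d : Fin (n + 1) → C) → (i : Fin (n + 1)) →
    (extractHom c i ⊗ₘ extractHom d i) ≫ tensorμ _ _ _ _ ≫
        (c i ⊗ d i) ◁ tupleMu (fun j => c (i.succAbove j)) (fun j => d (i.succAbove j)) =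
      tupleMu c d ≫ extractHom (fun j => c j ⊗ d j) i
  | 0, c, d, i => by
    induction i using Fin.cases with
    | zero => 
      have := whiskerLeft_tensorμ (c 0) (d 0) _ _ _ _ _ (tupleMu_tupleCast (c := fun i => c i.succ) 
        (d := fun i => d i.succ) (c' := fun i => c (Fin.succAbove 0 i)) 
        (d' := fun i => d (Fin.succAbove 0 i)) (by simp) (by simp))
      simp only [← Category.assoc] at this ⊢
      exact this
    | succ k => exact k.elim0
  | n + 1, c, d, i => by
    induction i using Fin.cases with
    | zero => 
      have := whiskerLeft_tensorμ (c 0) (d 0) _ _ _ _ _ (tupleMu_tupleCast (c := fun i => c i.succ) 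
        (d := fun i => d i.succ) (c' := fun i => c (Fin.succAbove 0 i)) 
        (d' := fun i => d (Fin.succAbove 0 i)) (by simp) (by simp))
      simp only [← Category.assoc] at this ⊢
      exact this
    | succ k =>
      exact extract_step (x := c 0) (y := d 0) (extractHom (fun j => c j.succ) k) (extractHom (fun j => d j.succ) k)
        (tupleMu _ _) _ _ (extractHom_tupleMu (fun j => c j.succ) (fun j => d j.succ) k) _ _
        (tupleCast (c := Fin.cons (α := fun _ => C) (c 0 ⊗ d 0)
          (fun j => c (k.succAbove j).succ ⊗ d (k.succAbove j).succ))
          (fun j => by induction j using Fin.cases <;> simp)) _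
        (tupleMu_tupleCast
          (c := Fin.cons (α := fun _ => C) (c 0) (fun j => c (k.succAbove j).succ))
          (d := Fin.cons (α := fun _ => C) (d 0) (fun j => d (k.succAbove j).succ))
          (c' := fun j => c (k.succ.succAbove j)) (d' := fun j => d (k.succ.succAbove j))
          (fun j => by induction j using Fin.cases <;> simp)
          (fun j => by induction j using Fin.cases <;> simp))

lemma permHom_tupleMu : {n : ℕ} → (σ : Equiv.Perm (Fin n)) → (c d : Fin n → C) →
    (permHom σ c ⊗ₘ permHom σ d) ≫ tupleMu (c ∘ σ) (d ∘ σ) =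
      tupleMu c d ≫ permHom σ (fun i => c i ⊗ d i)
  | 0, _, _, _ => by simp [permHom, tupleMu, tensorTuple]
  | n + 1, σ, c, d => by
    have h1 := extractHom_tupleMu c d (σ 0)
    have h2 := permHom_tupleMu (permTail σ) (fun j => c ((σ 0).succAbove j)) 
      (fun j => d ((σ 0).succAbove j))
    have h3 := tupleMu_tupleCast (c' := fun i => c (σ i.succ)) (d' := fun i => d (σ i.succ))
      (fun i => congrArg c (succAbove_permTail σ i)) (fun i => congrArg d (succAbove_permTail σ i))
    refine perm_step _ _ _ _ _ h1 _ _ _ (tupleMu (fun i => c (σ i.succ)) (fun i => d (σ i.succ))) ?_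
    rw [← tensorHom_comp_tensorHom, Category.assoc, h3]
    exact (reassoc_of% h2) _

end Coherence
section Insertion

open SymmetricMonoidalEnrichedCategory

variable {C : Type u₂} [Category.{w} C] [MonoidalCategory C] [SymmetricCategory C]

/-- `Zip l l' l''` says that `l''` is the list of the tensor products of the entries of `l`
and `l'`. -/
inductive Zip : List C → List C → List C → Type u₂
  | nil : Zip [] [] []
  | cons (a b : C) {l l' l'' : List C} (z : Zip l l' l'') :
      Zip (a :: l) (b :: l') ((a ⊗ b) :: l'')

/-- The canonical map `(⨂ l) ⊗ (⨂ l') ⟶ ⨂ (l ⊗ l')`. -/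
def Zip.mu : {l l' l'' : List C} → Zip l l' l'' →
    (tensorList l ⊗ tensorList l' ⟶ tensorList l'')
  | _, _, _, .nil => (λ_ (𝟙_ C)).hom
  | _, _, _, .cons a b (l := l) (l' := l') z =>
      tensorμ a (tensorList l) b (tensorList l') ≫ (a ⊗ b) ◁ z.mu

/-- Concatenation of zips. -/
def Zip.append : {l l' l'' r r' r'' : List C} → Zip l l' l'' → Zip r r' r'' →
    Zip (l ++ r) (l' ++ r') (l'' ++ r'')
  | _, _, _, _, _, _, .nil, z => z
  | _, _, _, _, _, _, .cons a b z, z' => .cons a b (z.append z')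

lemma Zip.exists_ofFn : {n : ℕ} → (c d : Fin n → C) →
    Nonempty (Zip (List.ofFn c) (List.ofFn d) (List.ofFn (fun i => c i ⊗ d i)))
  | 0, _, _ => by simpa using ⟨Zip.nil⟩
  | n + 1, c, d => by
    obtain ⟨z⟩ := Zip.exists_ofFn (fun i => c i.succ) (fun i => d i.succ)
    simp only [List.ofFn_succ]
    exact ⟨.cons _ _ z⟩

lemma Zip.exists_take (i : ℕ) {l l' l'' : List C} (z : Zip l l' l'') :
    Nonempty (Zip (l.take i) (l'.take i) (l''.take i)) := by
  induction z generalizing i with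
  | nil => simpa using ⟨Zip.nil⟩
  | cons a b z ih =>
    cases i with
    | zero => simpa using ⟨Zip.nil⟩
    | succ i =>
      obtain ⟨y⟩ := ih i
      exact ⟨.cons a b y⟩

lemma Zip.exists_drop (i : ℕ) {l l' l'' : List C} (z : Zip l l' l'') :
    Nonempty (Zip (l.drop i) (l'.drop i) (l''.drop i)) := by
  induction z generalizing i with
  | nil => simpa using ⟨Zip.nil⟩
  | cons a b z ih =>
    cases i with
    | zero => exact ⟨.cons a b z⟩
    | succ i => exact ih i

lemma tupleMu_zip : {n : ℕ} → (c d : Fin n → C) → {l l' l'' : List C} → (z : Zip l l' l'') →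
    (h : List.ofFn c = l) → (h' : List.ofFn d = l') →
    (h'' : List.ofFn (fun i => c i ⊗ d i) = l'') →
    tupleMu c d ≫ eqToHom ((tensorTuple_eq _).trans (congrArg tensorList h'')) =
      (eqToHom ((tensorTuple_eq _).trans (congrArg tensorList h)) ⊗ₘ
        eqToHom ((tensorTuple_eq _).trans (congrArg tensorList h'))) ≫ z.mu
  | 0, c, d, l, l', l'', z, h, h', h'' => by
    simp only [List.ofFn_zero] at h h' h''
    subst h h' h''
    cases z
    exact (Category.comp_id _).trans ((congrArg (· ≫ _) (id_tensorHom_id _ _)).trans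
      (Category.id_comp _)).symm
  | n + 1, c, d, l, l', l'', z, h, h', h'' => by
    rw [List.ofFn_succ] at h h' h''
    subst h h' h''
    cases z with
    | cons a b z =>
      have ih := tupleMu_zip (fun i => c i.succ) (fun i => d i.succ) z rfl rfl rfl
      have h := whiskerLeft_tensorμ (c 0) (d 0) _ _ _ _ _ ih.symm
      simp only [whiskerLeft_eqToHom] at h
      exact (Category.assoc _ _ _).trans h.symm

lemma append_nil_step {A B D : C} (f : A ⊗ B ⟶ D) :
    ((λ_ A).hom ⊗ₘ (λ_ B).hom) ≫ f =
      tensorμ (𝟙_ C) A (𝟙_ C) B ≫ ((λ_ (𝟙_ C)).hom ⊗ₘ f) ≫ (λ_ D).hom := by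
  rw [leftUnitor_monoidal]
  simp [MonoidalCategory.tensorHom_def]

lemma append_cons_step (a b : C) {A A' A'' R R' R'' X X' X'' : C} (p : A ⊗ A' ⟶ A'')
    (y : R ⊗ R' ⟶ R'') (g : A ⊗ R ⟶ X) (g' : A' ⊗ R' ⟶ X') (g'' : A'' ⊗ R'' ⟶ X'')
    (t : X ⊗ X' ⟶ X'') (H : (g ⊗ₘ g') ≫ t = tensorμ A R A' R' ≫ (p ⊗ₘ y) ≫ g'') :
    ((α_ a A R).hom ≫ a ◁ g ⊗ₘ (α_ b A' R').hom ≫ b ◁ g') ≫ tensorμ a X b X' ≫ (a ⊗ b) ◁ t =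
      tensorμ (a ⊗ A) R (b ⊗ A') R' ≫ ((tensorμ a A b A' ≫ (a ⊗ b) ◁ p) ⊗ₘ y) ≫
        (α_ (a ⊗ b) A'' R'').hom ≫ (a ⊗ b) ◁ g'' := by
  have h := associator_monoidal a A R b A' R'
  have h2 := whiskerLeft_tensorμ a b _ _ _ _ _ H
  have h3 : ((tensorμ a A b A' ≫ (a ⊗ b) ◁ p) ⊗ₘ y) =
      tensorμ a A b A' ▷ (R ⊗ R') ≫ ((a ⊗ b) ◁ p ⊗ₘ y) := by
    simp only [MonoidalCategory.tensorHom_def, comp_whiskerRight, Category.assoc]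
  have h4 := associator_naturality (𝟙 (a ⊗ b)) p y
  rw [id_tensorHom, id_tensorHom] at h4
  rw [← tensorHom_comp_tensorHom, Category.assoc, h2, h3, Category.assoc, reassoc_of% h4,
    reassoc_of% h, MonoidalCategory.whiskerLeft_comp]

lemma appendHom_zip {m m' m'' r r' r'' : List C} (z : Zip m m' m'') (y : Zip r r' r'') :
    (appendHom m r ⊗ₘ appendHom m' r') ≫ (z.append y).mu =
      tensorμ _ _ _ _ ≫ (z.mu ⊗ₘ y.mu) ≫ appendHom m'' r'' := by
  induction z with
  | nil => exact append_nil_step y.mu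
  | cons a b z ih => exact append_cons_step a b z.mu y.mu _ _ _ _ ih

variable (E : Type u₁) [Category.{v} E] [MonoidalCategory E] [SymmetricCategory E]
  [EnrichedOrdinaryCategory E C] [SymmetricMonoidalEnrichedCategory E C]

/-- The action on hom objects of the enriched functor
`x ↦ l₁ ⊗ ⋯ ⊗ lₚ ⊗ x ⊗ r₁ ⊗ ⋯ ⊗ r_q`, up to the canonical isomorphisms
`(⨂ m) ⊗ (⨂ r) ≅ ⨂ (m ++ r)`. -/
def insertHom : (l : List C) → (d : C) → (r m : List C) →
    ((d ⟶[E] tensorList m) ⟶ (tensorList (l ++ d :: r) ⟶[E] tensorList (l ++ m ++ r)))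
  | [], d, r, m => eWhiskerRight E d (tensorList m) (tensorList r) ≫
      eHomWhiskerLeft E (d ⊗ tensorList r) (appendHom m r)
  | a :: l, d, r, m => insertHom l d r m ≫
      eWhiskerLeft E a (tensorList (l ++ d :: r)) (tensorList (l ++ m ++ r))

variable {E}

lemma Sq.post {Z : E} {X Y X' Y' W W' : C} {u : Z ⟶ (X ⟶[E] Y)} {v : Z ⟶ (X' ⟶[E] Y')}
    {a : X ⟶ X'} {b : Y ⟶ Y'} (h : Sq u v a b) (p : Y ⟶ W) (q : Y' ⟶ W') (t : W ⟶ W')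
    (e : p ≫ t = b ≫ q) :
    Sq (u ≫ eHomWhiskerLeft E X p) (v ≫ eHomWhiskerLeft E X' q) a t := by
  unfold Sq at *
  rw [Category.assoc, ← eHomWhiskerLeft_comp, e, eHomWhiskerLeft_comp, reassoc_of% h,
    Category.assoc, eHom_whisker_exchange]

lemma sq_eId {X Y : C} (f : X ⟶ Y) : Sq (eId E X) (eId E Y) f f := by
  have h1 : eId E X ≫ eHomWhiskerLeft E X f = eHomEquiv E f := by
    conv_rhs => rw [← Category.id_comp f, eHomEquiv_comp]
    simp only [eHomWhiskerLeft, MonoidalCategory.tensorHom_def, eHomEquiv_id,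
      rightUnitor_inv_naturality_assoc, Category.assoc, unitors_inv_equal]
  have h2 : eId E Y ≫ eHomWhiskerRight E f Y = eHomEquiv E f := by
    conv_rhs => rw [← Category.comp_id f, eHomEquiv_comp]
    simp only [eHomWhiskerRight, MonoidalCategory.tensorHom_def', eHomEquiv_id,
      leftUnitor_inv_naturality_assoc, Category.assoc]
  exact h1.trans h2.symm

lemma comp_eWhiskerRight {Z : E} {X Y : C} (u : Z ⟶ (X ⟶[E] Y)) (W : C) :
    u ≫ eWhiskerRight E X Y W = (ρ_ Z).inv ≫ box u (eId E W) := by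
  simp [eWhiskerRight, box, MonoidalCategory.tensorHom_def]

lemma comp_eWhiskerLeft {Z : E} {X Y : C} (u : Z ⟶ (X ⟶[E] Y)) (W : C) :
    u ≫ eWhiskerLeft E W X Y = (λ_ Z).inv ≫ box (eId E W) u := by
  simp [eWhiskerLeft, box, MonoidalCategory.tensorHom_def']

lemma Sq.eWhiskerLeft {Z : E} {X Y X' Y' : C} {u : Z ⟶ (X ⟶[E] Y)} {v : Z ⟶ (X' ⟶[E] Y')}
    {a : X ⟶ X'} {b : Y ⟶ Y'} (h : Sq u v a b) {W W' : C} (f : W ⟶ W') :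
    Sq (u ≫ eWhiskerLeft E W X Y) (v ≫ eWhiskerLeft E W' X' Y') (f ⊗ₘ a) (f ⊗ₘ b) := by
  rw [comp_eWhiskerLeft, comp_eWhiskerLeft]
  exact ((sq_eId f).tensor h).pre _

lemma Sq.eWhiskerRight {Z : E} {X Y X' Y' : C} {u : Z ⟶ (X ⟶[E] Y)} {v : Z ⟶ (X' ⟶[E] Y')}
    {a : X ⟶ X'} {b : Y ⟶ Y'} (h : Sq u v a b) {W W' : C} (f : W ⟶ W') :
    Sq (u ≫ eWhiskerRight E X Y W) (v ≫ eWhiskerRight E X' Y' W') (a ⊗ₘ f) (b ⊗ₘ f) := by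
  rw [comp_eWhiskerRight, comp_eWhiskerRight]
  exact (h.tensor (sq_eId f)).pre _

lemma insertHom_zip {Z Z' : E} {l l' l'' r r' r'' m m' m'' : List C} (z : Zip l l' l'')
    (y : Zip r r' r'') (t : Zip m m' m'') (d d' : C) (u : Z ⟶ (d ⟶[E] tensorList m))
    (u' : Z' ⟶ (d' ⟶[E] tensorList m')) :
    Sq (box (u ≫ insertHom E l d r m) (u' ≫ insertHom E l' d' r' m'))
      ((box u u' ≫ eHomWhiskerLeft E (d ⊗ d') t.mu) ≫ insertHom E l'' (d ⊗ d') r'' m'')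
      (z.append (.cons d d' y)).mu ((z.append t).append y).mu := by
  induction z with
  | nil =>
    have h1 := Sq.whiskerRight u u' (tensorList r) (tensorList r')
    have h2 : Sq (box u u') (box u u' ≫ eHomWhiskerLeft E (d ⊗ d') t.mu) (𝟙 _) t.mu := by
      simp [Sq]
    have h3 := h1.trans (Sq.eWhiskerRight h2 y.mu)
    have h4 := h3.post (appendHom m r ⊗ₘ appendHom m' r') (appendHom m'' r'') (t.append y).mu
      (by rw [appendHom_zip, Category.assoc])
    rw [← box_whiskerLeft, id_tensorHom] at h4
    simp only [Category.assoc] at h4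
    simp only [insertHom, Category.assoc]
    exact h4
  | cons a b z ih =>
    rename_i l₁ l₂ l₃
    simp only [insertHom]
    have h1 := Sq.whiskerLeft (u ≫ insertHom E l₁ d r m) (u' ≫ insertHom E l₂ d' r' m') a b
    have h2 := h1.trans (Sq.eWhiskerLeft ih (𝟙 (a ⊗ b)))
    simp only [id_tensorHom] at h2
    simp only [Category.assoc] at h2 ⊢
    exact h2

lemma comp_middle {Z Z' : E} {X Y Y' W : C} (a : Z ⟶ (X ⟶[E] Y)) (b : Z' ⟶ (Y' ⟶[E] W))
    (p : Y ⟶ Y') :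
    ((a ≫ eHomWhiskerLeft E X p) ⊗ₘ b) ≫ eComp E X Y' W =
      (a ⊗ₘ (b ≫ eHomWhiskerRight E p W)) ≫ eComp E X Y W := by
  have h : eHomWhiskerLeft E X p ▷ (Y' ⟶[E] W) ≫ eComp E X Y' W =
      (X ⟶[E] Y) ◁ eHomWhiskerRight E p W ≫ eComp E X Y W := by
    simp only [eHomWhiskerLeft, eHomWhiskerRight, MonoidalCategory.whiskerLeft_comp,
      MonoidalCategory.comp_whiskerRight, Category.assoc, ← e_assoc]
    monoidal
  have h1 : ((a ≫ eHomWhiskerLeft E X p) ⊗ₘ b) = (a ⊗ₘ b) ≫ eHomWhiskerLeft E X p ▷ _ := by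
    simp [MonoidalCategory.tensorHom_def']
  have h2 : (a ⊗ₘ (b ≫ eHomWhiskerRight E p W)) = (a ⊗ₘ b) ≫ _ ◁ eHomWhiskerRight E p W := by
    simp [MonoidalCategory.tensorHom_def]
  rw [h1, h2, Category.assoc, h, Category.assoc]

end Insertion

section Operads

/-- `IsGraft c i c' e` says that `e` is the tuple `c ◁ᵢ c'`, that is
`(c₀, …, cᵢ₋₁, c'₀, …, c'ₘ₋₁, cᵢ₊₁, …, cₙ₋₁)`. -/
def IsGraft {A : Type*} {n m k : ℕ} (c : Fin n → A) (i : Fin n) (c' : Fin m → A)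
    (e : Fin k → A) : Prop :=
  List.ofFn e = (List.ofFn c).take i ++ List.ofFn c' ++ (List.ofFn c).drop (i + 1)

lemma IsGraft.map {A B : Type*} (f : A → B) {n m k : ℕ} {c : Fin n → A} {i : Fin n}
    {c' : Fin m → A} {e : Fin k → A} (h : IsGraft c i c' e) :
    IsGraft (f ∘ c) i (f ∘ c') (f ∘ e) := by
  have h' := congrArg (List.map f) h
  simpa only [IsGraft, List.map_append, List.map_take, List.map_drop, List.map_ofFn] using h'

/-- The underlying data of a coloured operad enriched in `E`: operation objects with an action
of the symmetric groups, partial compositions and units. -/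
structure OperadData (E : Type u₁) [Category.{v} E] [MonoidalCategory E] where
  /-- the set of colours -/
  Ob : Type w
  /-- the object `P(c₀, …, cₙ₋₁; x)` of operations -/
  hom {n : ℕ} (c : Fin n → Ob) (x : Ob) : E
  /-- the map `σ^* : P(c; x) ⟶ P(c^σ; x)`, where `c^σ = (c_{σ(0)}, …, c_{σ(n-1)})` -/
  symm {n : ℕ} (σ : Equiv.Perm (Fin n)) (c : Fin n → Ob) (x : Ob) : hom c x ⟶ hom (c ∘ σ) x
  /-- the partial composition `γᵢ : P(c; x) ⊗ P(c'; cᵢ) ⟶ P(c ◁ᵢ c'; x)` (the colour `cᵢ` and the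
  tuple `c ◁ᵢ c'` are named by variables) -/
  comp {n m k : ℕ} (c : Fin n → Ob) (i : Fin n) (d : Ob) (c' : Fin m → Ob) (e : Fin k → Ob)
    (x : Ob) (hd : c i = d) (he : IsGraft c i c' e) : hom c x ⊗ hom c' d ⟶ hom e x
  /-- the unit of the colour `x` -/
  unit (x : Ob) : 𝟙_ E ⟶ hom (fun _ : Fin 1 => x) x

/-- A morphism of (data of) enriched operads. -/
structure OperadData.Hom {E : Type u₁} [Category.{v} E] [MonoidalCategory E]
    (P : OperadData.{w} E) (Q : OperadData.{w'} E) where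
  /-- the function on colours -/
  obj : P.Ob → Q.Ob
  /-- the maps on operations -/
  map {n : ℕ} (c : Fin n → P.Ob) (x : P.Ob) : P.hom c x ⟶ Q.hom (obj ∘ c) (obj x)
  map_symm {n : ℕ} (σ : Equiv.Perm (Fin n)) (c : Fin n → P.Ob) (x : P.Ob) :
    P.symm σ c x ≫ map (c ∘ σ) x = map c x ≫ Q.symm σ (obj ∘ c) (obj x)
  map_comp {n m k : ℕ} (c : Fin n → P.Ob) (i : Fin n) (d : P.Ob) (c' : Fin m → P.Ob)
    (e : Fin k → P.Ob) (x : P.Ob) (hd : c i = d) (he : IsGraft c i c' e) :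
    P.comp c i d c' e x hd he ≫ map e x =
      (map c x ⊗ₘ map c' d) ≫ Q.comp (obj ∘ c) i (obj d) (obj ∘ c') (obj ∘ e) (obj x)
        (congrArg obj hd) (he.map obj)
  map_unit (x : P.Ob) : P.unit x ≫ map (fun _ : Fin 1 => x) x = Q.unit (obj x)

/-- Composition of morphisms. -/
def OperadData.Hom.trans {E : Type u₁} [Category.{v} E] [MonoidalCategory E]
    {P : OperadData.{w} E} {Q : OperadData.{w'} E} {R : OperadData.{w''} E}
    (f : P.Hom Q) (g : Q.Hom R) : P.Hom R where
  obj x := g.obj (f.obj x)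
  map c x := f.map c x ≫ g.map (f.obj ∘ c) (f.obj x)
  map_symm σ c x := by
    rw [← Category.assoc, f.map_symm, Category.assoc, Category.assoc]
    exact congrArg _ (g.map_symm σ (f.obj ∘ c) (f.obj x))
  map_comp c i d c' e x hd he := by
    rw [← Category.assoc, f.map_comp, Category.assoc, g.map_comp, ← tensorHom_comp_tensorHom,
      Category.assoc]
    rfl
  map_unit x := by
    rw [← Category.assoc, f.map_unit]
    exact g.map_unit _

/-- A (coloured, symmetric) operad enriched in `E`. -/
structure EnrichedOperad (E : Type u₁) [Category.{v} E] [MonoidalCategory E] [SymmetricCategory E]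
    extends OperadData.{w} E where
  symm_refl {n : ℕ} (c : Fin n → Ob) (x : Ob) : symm (Equiv.refl (Fin n)) c x = 𝟙 (hom c x)
  symm_trans {n : ℕ} (μ σ : Equiv.Perm (Fin n)) (c : Fin n → Ob) (x : Ob) :
    symm μ c x ≫ symm σ (c ∘ μ) x = symm (σ.trans μ) c x
  unit_comp {n : ℕ} (c : Fin n → Ob) (x : Ob) (h : IsGraft (fun _ : Fin 1 => x) 0 c c) :
    unit x ▷ hom c x ≫ comp (fun _ : Fin 1 => x) 0 x c c x rfl h = (λ_ (hom c x)).hom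
  comp_unit {n : ℕ} (c : Fin n → Ob) (i : Fin n) (d x : Ob) (hd : c i = d)
    (h : IsGraft c i (fun _ : Fin 1 => d) c) :
    hom c x ◁ unit d ≫ comp c i d (fun _ : Fin 1 => d) c x hd h = (ρ_ (hom c x)).hom
  /-- sequential associativity: `(p ∘ᵢ q) ∘ᵢ₊ⱼ r = p ∘ᵢ (q ∘ⱼ r)` -/
  assoc_seq {n m l k k' t : ℕ} (c : Fin n → Ob) (i : Fin n) (d : Ob) (c' : Fin m → Ob) (j : Fin m)
    (d' : Ob) (c'' : Fin l → Ob) (e : Fin k → Ob) (a : Fin k) (e' : Fin k' → Ob) (f : Fin t → Ob)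
    (x : Ob) (hd : c i = d) (hd' : c' j = d') (ha : (a : ℕ) = i + j) (hd'' : e a = d')
    (h₁ : IsGraft c i c' e) (h₂ : IsGraft e a c'' f) (h₃ : IsGraft c' j c'' e')
    (h₄ : IsGraft c i e' f) :
    comp c i d c' e x hd h₁ ▷ hom c'' d' ≫ comp e a d' c'' f x hd'' h₂ =
      (α_ _ _ _).hom ≫ hom c x ◁ comp c' j d' c'' e' d hd' h₃ ≫ comp c i d e' f x hd h₄
  /-- parallel associativity: `(p ∘ᵢ q) ∘ⱼ₊ₘ₋₁ r = (p ∘ⱼ r) ∘ᵢ q` for `i < j`, where `q` has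
  arity `m` -/
  assoc_par {n m l k k' t : ℕ} (c : Fin n → Ob) (i j : Fin n) (d d' : Ob) (c' : Fin m → Ob)
    (c'' : Fin l → Ob) (e : Fin k → Ob) (a : Fin k) (e' : Fin k' → Ob) (b : Fin k')
    (f : Fin t → Ob) (x : Ob) (hij : i < j) (hd : c i = d) (hd' : c j = d')
    (ha : (a : ℕ) + 1 = j + m) (hb : (b : ℕ) = i) (hea : e a = d') (heb : e' b = d)
    (h₁ : IsGraft c i c' e) (h₂ : IsGraft e a c'' f) (h₃ : IsGraft c j c'' e')
    (h₄ : IsGraft e' b c' f) :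
    comp c i d c' e x hd h₁ ▷ hom c'' d' ≫ comp e a d' c'' f x hea h₂ =
      (α_ _ _ _).hom ≫ hom c x ◁ (β_ (hom c' d) (hom c'' d')).hom ≫ (α_ _ _ _).inv ≫
        comp c j d' c'' e' x hd' h₃ ▷ hom c' d ≫ comp e' b d c' f x heb h₄
  /-- equivariance: `p^σ ∘ᵢ q^τ = (p ∘_{σ(i)} q)^ρ`, where `ρ` is the block permutation induced by
  `σ` and `τ`; it is described on the positions of the two composites, which are labelled by
  positions of the inputs of `p` and `q` -/
  equivariance {n m k : ℕ} (σ : Equiv.Perm (Fin n)) (τ : Equiv.Perm (Fin m))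
    (ρ : Equiv.Perm (Fin k)) (c : Fin n → Ob) (i : Fin n) (d : Ob) (c' : Fin m → Ob)
    (e : Fin k → Ob) (x : Ob) (hd : c (σ i) = d) (h : IsGraft c (σ i) c' e)
    (h' : IsGraft (c ∘ σ) i (c' ∘ τ) (e ∘ ρ)) (g g' : Fin k → Fin n ⊕ Fin m)
    (hg : IsGraft Sum.inl (σ i) Sum.inr g) (hg' : IsGraft Sum.inl i Sum.inr g')
    (hρ : ∀ a, g (ρ a) = Sum.map σ τ (g' a)) :
    (symm σ c x ⊗ₘ symm τ c' d) ≫ comp (c ∘ σ) i d (c' ∘ τ) (e ∘ ρ) x hd h' =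
      comp c (σ i) d c' e x hd h ≫ symm ρ e x

variable {E : Type u₁} [Category.{v} E] [MonoidalCategory E] [SymmetricCategory E]

lemma had_left_unit {A A' B B' : E} (u : 𝟙_ E ⟶ A) (u' : 𝟙_ E ⟶ A') (γ : A ⊗ B ⟶ B)
    (γ' : A' ⊗ B' ⟶ B') (h : u ▷ B ≫ γ = (λ_ B).hom) (h' : u' ▷ B' ≫ γ' = (λ_ B').hom) :
    ((λ_ (𝟙_ E)).inv ≫ (u ⊗ₘ u')) ▷ (B ⊗ B') ≫ tensorμ A A' B B' ≫ (γ ⊗ₘ γ') =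
      (λ_ (B ⊗ B')).hom := by
  have e1 : (u ⊗ₘ u') ▷ (B ⊗ B') ≫ tensorμ A A' B B' =
      tensorμ _ _ _ _ ≫ (u ▷ B ⊗ₘ u' ▷ B') := tensorμ_natural_left _ _ _ _
  rw [comp_whiskerRight, Category.assoc, reassoc_of% e1, tensorHom_comp_tensorHom, h, h']
  exact (tensor_left_unitality B B').symm

lemma had_right_unit {A A' B B' : E} (u : 𝟙_ E ⟶ A) (u' : 𝟙_ E ⟶ A') (γ : B ⊗ A ⟶ B)
    (γ' : B' ⊗ A' ⟶ B') (h : B ◁ u ≫ γ = (ρ_ B).hom) (h' : B' ◁ u' ≫ γ' = (ρ_ B').hom) :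
    (B ⊗ B') ◁ ((λ_ (𝟙_ E)).inv ≫ (u ⊗ₘ u')) ≫ tensorμ B B' A A' ≫ (γ ⊗ₘ γ') =
      (ρ_ (B ⊗ B')).hom := by
  have e1 : (B ⊗ B') ◁ (u ⊗ₘ u') ≫ tensorμ B B' A A' =
      tensorμ _ _ _ _ ≫ (B ◁ u ⊗ₘ B' ◁ u') := tensorμ_natural_right _ _ _ _
  rw [MonoidalCategory.whiskerLeft_comp, Category.assoc, reassoc_of% e1, tensorHom_comp_tensorHom, h, h']
  exact (tensor_right_unitality B B').symm

lemma had_seq {A A' B B' D D' M M' N N' Z Z' : E} (γ : A ⊗ B ⟶ M) (γ' : A' ⊗ B' ⟶ M')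
    (δ : M ⊗ D ⟶ Z) (δ' : M' ⊗ D' ⟶ Z') (ε : B ⊗ D ⟶ N) (ε' : B' ⊗ D' ⟶ N')
    (ζ : A ⊗ N ⟶ Z) (ζ' : A' ⊗ N' ⟶ Z')
    (h : γ ▷ D ≫ δ = (α_ _ _ _).hom ≫ A ◁ ε ≫ ζ)
    (h' : γ' ▷ D' ≫ δ' = (α_ _ _ _).hom ≫ A' ◁ ε' ≫ ζ') :
    (tensorμ A A' B B' ≫ (γ ⊗ₘ γ')) ▷ (D ⊗ D') ≫ tensorμ M M' D D' ≫ (δ ⊗ₘ δ') =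
      (α_ _ _ _).hom ≫ (A ⊗ A') ◁ (tensorμ B B' D D' ≫ (ε ⊗ₘ ε')) ≫
        tensorμ A A' N N' ≫ (ζ ⊗ₘ ζ') := by
  rw [comp_whiskerRight, Category.assoc, MonoidalCategory.whiskerLeft_comp, Category.assoc]
  rw [tensorμ_natural_left_assoc, tensorμ_natural_right_assoc]
  rw [tensorHom_comp_tensorHom, tensorHom_comp_tensorHom, h, h', ← tensorHom_comp_tensorHom]
  have := tensor_associativity A A' B B' D D'
  rw [reassoc_of% this]

lemma had_par {A A' B B' D D' M M' N N' Z Z' : E} (γ : A ⊗ B ⟶ M) (γ' : A' ⊗ B' ⟶ M')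
    (δ : M ⊗ D ⟶ Z) (δ' : M' ⊗ D' ⟶ Z') (ε : A ⊗ D ⟶ N) (ε' : A' ⊗ D' ⟶ N')
    (ζ : N ⊗ B ⟶ Z) (ζ' : N' ⊗ B' ⟶ Z')
    (h : γ ▷ D ≫ δ = (α_ _ _ _).hom ≫ A ◁ (β_ B D).hom ≫ (α_ _ _ _).inv ≫ ε ▷ B ≫ ζ)
    (h' : γ' ▷ D' ≫ δ' =
      (α_ _ _ _).hom ≫ A' ◁ (β_ B' D').hom ≫ (α_ _ _ _).inv ≫ ε' ▷ B' ≫ ζ') :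
    (tensorμ A A' B B' ≫ (γ ⊗ₘ γ')) ▷ (D ⊗ D') ≫ tensorμ M M' D D' ≫ (δ ⊗ₘ δ') =
      (α_ _ _ _).hom ≫ (A ⊗ A') ◁ (β_ (B ⊗ B') (D ⊗ D')).hom ≫ (α_ _ _ _).inv ≫
        (tensorμ A A' D D' ≫ (ε ⊗ₘ ε')) ▷ (B ⊗ B') ≫ tensorμ N N' B B' ≫ (ζ ⊗ₘ ζ') := by
  have e : (α_ (A ⊗ A') (D ⊗ D') (B ⊗ B')).inv ≫ (tensorμ A A' D D' ▷ (B ⊗ B')) ≫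
      tensorμ (A ⊗ D) (A' ⊗ D') B B' = (A ⊗ A') ◁ tensorμ D D' B B' ≫
      tensorμ A A' (D ⊗ B) (D' ⊗ B') ≫ ((α_ A D B).inv ⊗ₘ (α_ A' D' B').inv) := by
    rw [Iso.inv_comp_eq]
    have := tensor_associativity A A' D D' B B'
    have h2 : ((α_ A D B).hom ⊗ₘ (α_ A' D' B').hom) ≫ ((α_ A D B).inv ⊗ₘ (α_ A' D' B').inv) = 𝟙 _ := by
      rw [tensorHom_comp_tensorHom]; simp
    rw [← reassoc_of% this, h2, Category.comp_id]
  rw [comp_whiskerRight, Category.assoc, comp_whiskerRight, Category.assoc]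
  rw [tensorμ_natural_left_assoc, tensorμ_natural_left_assoc]
  rw [tensorHom_comp_tensorHom, tensorHom_comp_tensorHom, h, h', ← tensorHom_comp_tensorHom,
    ← tensorHom_comp_tensorHom, ← tensorHom_comp_tensorHom, reassoc_of% e]
  have := tensor_associativity A A' B B' D D'
  rw [reassoc_of% this, ← tensorμ_natural_right_assoc, ← MonoidalCategory.whiskerLeft_comp_assoc,
     ← MonoidalCategory.whiskerLeft_comp_assoc, tensorμ_braiding]

lemma had_equi {A A' B B' C C' D D' Z Z' Y Y' : E} (a : A ⟶ C) (a' : A' ⟶ C') (b : B ⟶ D) (b' : B' ⟶ D')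
   (γ : C ⊗ D ⟶ Z) (γ' : C' ⊗ D' ⟶ Z') (δ : A ⊗ B ⟶ Y) (δ' : A' ⊗ B' ⟶ Y') (r : Y ⟶ Z) (r' : Y' ⟶ Z')
   (h : (a ⊗ₘ b) ≫ γ = δ ≫ r) (h' : (a' ⊗ₘ b') ≫ γ' = δ' ≫ r') :
   ((a ⊗ₘ a') ⊗ₘ (b ⊗ₘ b')) ≫ tensorμ C C' D D' ≫ (γ ⊗ₘ γ') =
     (tensorμ A A' B B' ≫ (δ ⊗ₘ δ')) ≫ (r ⊗ₘ r') := by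
  rw [tensorμ_natural_assoc, tensorHom_comp_tensorHom, h, h', ← tensorHom_comp_tensorHom,
    Category.assoc]
/-- The Hadamard tensor product of (data of) operads. -/
def OperadData.hadamard (P : OperadData.{w} E) (Q : OperadData.{w'} E) :
    OperadData.{max w w'} E where
  Ob := P.Ob × Q.Ob
  hom c x := P.hom (Prod.fst ∘ c) x.1 ⊗ Q.hom (Prod.snd ∘ c) x.2
  symm σ c x := P.symm σ (Prod.fst ∘ c) x.1 ⊗ₘ Q.symm σ (Prod.snd ∘ c) x.2
  comp c i d c' e x hd he :=
    tensorμ _ _ _ _ ≫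
      (P.comp (Prod.fst ∘ c) i d.1 (Prod.fst ∘ c') (Prod.fst ∘ e) x.1 (congrArg Prod.fst hd)
          (he.map Prod.fst) ⊗ₘ
        Q.comp (Prod.snd ∘ c) i d.2 (Prod.snd ∘ c') (Prod.snd ∘ e) x.2 (congrArg Prod.snd hd)
          (he.map Prod.snd))
  unit x := (λ_ (𝟙_ E)).inv ≫ (P.unit x.1 ⊗ₘ Q.unit x.2)

/-- The Hadamard tensor product of operads. -/
def EnrichedOperad.hadamard (P : EnrichedOperad.{w} E) (Q : EnrichedOperad.{w'} E) :
    EnrichedOperad.{max w w'} E where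
  toOperadData := P.toOperadData.hadamard Q.toOperadData
  symm_refl c x := by
    simp only [OperadData.hadamard, P.symm_refl, Q.symm_refl]
    exact id_tensorHom_id _ _
  symm_trans μ σ c x := by
    simp only [OperadData.hadamard, tensorHom_comp_tensorHom, ← P.symm_trans, ← Q.symm_trans]
    rfl
  unit_comp c x h :=
    had_left_unit _ _ _ _ (P.unit_comp (Prod.fst ∘ c) x.1 (h.map _))
      (Q.unit_comp (Prod.snd ∘ c) x.2 (h.map _))
  comp_unit c i d x hd h :=
    had_right_unit _ _ _ _
      (P.comp_unit (Prod.fst ∘ c) i d.1 x.1 (congrArg Prod.fst hd) (h.map _))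
      (Q.comp_unit (Prod.snd ∘ c) i d.2 x.2 (congrArg Prod.snd hd) (h.map _))
  assoc_seq c i d c' j d' c'' e a e' f x hd hd' ha hd'' h₁ h₂ h₃ h₄ :=
    had_seq _ _ _ _ _ _ _ _
      (P.assoc_seq (Prod.fst ∘ c) i d.1 (Prod.fst ∘ c') j d'.1 (Prod.fst ∘ c'')
        (Prod.fst ∘ e) a (Prod.fst ∘ e') (Prod.fst ∘ f) x.1 (congrArg _ hd) (congrArg _ hd') ha
        (congrArg _ hd'') (h₁.map _) (h₂.map _) (h₃.map _) (h₄.map _))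
      (Q.assoc_seq (Prod.snd ∘ c) i d.2 (Prod.snd ∘ c') j d'.2 (Prod.snd ∘ c'')
        (Prod.snd ∘ e) a (Prod.snd ∘ e') (Prod.snd ∘ f) x.2 (congrArg _ hd) (congrArg _ hd') ha
        (congrArg _ hd'') (h₁.map _) (h₂.map _) (h₃.map _) (h₄.map _))
  assoc_par c i j d d' c' c'' e a e' b f x hij hd hd' ha hb hea heb h₁ h₂ h₃ h₄ :=
    had_par _ _ _ _ _ _ _ _
      (P.assoc_par (Prod.fst ∘ c) i j d.1 d'.1 (Prod.fst ∘ c') (Prod.fst ∘ c'')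
        (Prod.fst ∘ e) a (Prod.fst ∘ e') b (Prod.fst ∘ f) x.1 hij (congrArg _ hd)
        (congrArg _ hd') ha hb (congrArg _ hea) (congrArg _ heb)
        (h₁.map _) (h₂.map _) (h₃.map _) (h₄.map _))
      (Q.assoc_par (Prod.snd ∘ c) i j d.2 d'.2 (Prod.snd ∘ c') (Prod.snd ∘ c'')
        (Prod.snd ∘ e) a (Prod.snd ∘ e') b (Prod.snd ∘ f) x.2 hij (congrArg _ hd)
        (congrArg _ hd') ha hb (congrArg _ hea) (congrArg _ heb)
        (h₁.map _) (h₂.map _) (h₃.map _) (h₄.map _))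
  equivariance σ τ ρ c i d c' e x hd h h' g g' hg hg' hρ :=
    had_equi _ _ _ _ _ _ _ _ _ _
      (P.equivariance σ τ ρ (Prod.fst ∘ c) i d.1 (Prod.fst ∘ c') (Prod.fst ∘ e) x.1
        (congrArg Prod.fst hd) (h.map _) (h'.map Prod.fst) g g' hg hg' hρ)
      (Q.equivariance σ τ ρ (Prod.snd ∘ c) i d.2 (Prod.snd ∘ c') (Prod.snd ∘ e) x.2
        (congrArg Prod.snd hd) (h.map _) (h'.map Prod.snd) g g' hg hg' hρ)

end Operads

section Coalgebras

open SymmetricMonoidalEnrichedCategory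

section CoEnd

variable {E : Type u₁} [Category.{v} E] [MonoidalCategory E] [SymmetricCategory E]
  {C : Type u₂} [Category.{w} C] [MonoidalCategory C] [SymmetricCategory C]
  [EnrichedOrdinaryCategory E C] [SymmetricMonoidalEnrichedCategory E C]

lemma ofFn_split {A : Type*} {n : ℕ} (c : Fin n → A) (i : Fin n) {d : A} (hd : c i = d) :
    List.ofFn c = (List.ofFn c).take i ++ d :: (List.ofFn c).drop (i + 1) := by
  subst hd
  have h : (i : ℕ) < (List.ofFn c).length := by simp
  have := List.getElem_cons_drop h
  rw [List.getElem_ofFn] at this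
  simp only [Fin.eta] at this
  rw [this, List.take_append_drop]

/-- The isomorphism `x₀ ⊗ ⋯ ⊗ xₙ₋₁ ⟶ x₀ ⊗ ⋯ ⊗ d ⊗ ⋯ ⊗ xₙ₋₁` for `d = xᵢ`. -/
def splitHom {n : ℕ} (c : Fin n → C) (i : Fin n) {d : C} (hd : c i = d) :
    tensorTuple c ⟶ tensorList ((List.ofFn c).take i ++ d :: (List.ofFn c).drop (i + 1)) :=
  eqToHom ((tensorTuple_eq c).trans (congrArg tensorList (ofFn_split c i hd)))

/-- The isomorphism between the two ways of writing the tensor product of the tuple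
`c ◁ᵢ c'`. -/
def graftHom {n m k : ℕ} {c : Fin n → C} {i : Fin n} {c' : Fin m → C} {e : Fin k → C}
    (he : IsGraft c i c' e) :
    tensorList ((List.ofFn c).take i ++ List.ofFn c' ++ (List.ofFn c).drop (i + 1)) ⟶
      tensorTuple e :=
  eqToHom ((tensorTuple_eq e).trans (congrArg tensorList he)).symm

variable (E) in
/-- Partial composition of cooperations: it sends `p : x ⟶ c₀ ⊗ ⋯ ⊗ cₙ₋₁` and
`q : cᵢ ⟶ c'₀ ⊗ ⋯ ⊗ c'ₘ₋₁` to `(c₀ ⊗ ⋯ ⊗ q ⊗ ⋯ ⊗ cₙ₋₁) ∘ p`. -/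
def coComp {n m k : ℕ} (c : Fin n → C) (i : Fin n) (d : C) (c' : Fin m → C) (e : Fin k → C)
    (x : C) (hd : c i = d) (he : IsGraft c i c' e) :
    (x ⟶[E] tensorTuple c) ⊗ (d ⟶[E] tensorTuple c') ⟶ (x ⟶[E] tensorTuple e) :=
  (eHomWhiskerLeft E x (splitHom c i hd) ⊗ₘ
      (eHomWhiskerLeft E d (eqToHom (tensorTuple_eq c')) ≫
        insertHom E ((List.ofFn c).take i) d ((List.ofFn c).drop (i + 1)) (List.ofFn c'))) ≫
    eComp E _ _ _ ≫ eHomWhiskerLeft E x (graftHom he)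

lemma comp_step {x₁ x₂ A₁ A₂ S₁ S₂ S₃ N₁ N₂ N₃ d₁ d₂ B₁ B₂ F₁ F₂ F₃ M : C}
    (s₁ : A₁ ⟶ S₁) (s₂ : A₂ ⟶ S₂) (v₁ : (d₁ ⟶[E] B₁) ⟶ (S₁ ⟶[E] N₁))
    (v₂ : (d₂ ⟶[E] B₂) ⟶ (S₂ ⟶[E] N₂)) (b₁ : N₁ ⟶ F₁) (b₂ : N₂ ⟶ F₂) (b₃ : N₃ ⟶ F₃)
    (t : F₁ ⊗ F₂ ⟶ F₃) (μN : N₁ ⊗ N₂ ⟶ N₃) (μS : S₁ ⊗ S₂ ⟶ S₃)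
    (hb : (b₁ ⊗ₘ b₂) ≫ t = μN ≫ b₃)
    (A₃ : C) (μA : A₁ ⊗ A₂ ⟶ A₃) (s₃ : A₃ ⟶ S₃) (hs : μA ≫ s₃ = (s₁ ⊗ₘ s₂) ≫ μS)
    (v₃ : ((d₁ ⊗ d₂) ⟶[E] M) ⟶ (S₃ ⟶[E] N₃)) (g : (d₁ ⟶[E] B₁) ⊗ (d₂ ⟶[E] B₂) ⟶ ((d₁ ⊗ d₂) ⟶[E] M))
    (h : Sq (box v₁ v₂) (g ≫ v₃) μS μN) :
    (tensorμ (x₁ ⟶[E] A₁) (x₂ ⟶[E] A₂) (d₁ ⟶[E] B₁) (d₂ ⟶[E] B₂) ≫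
      ((eHomWhiskerLeft E x₁ s₁ ⊗ₘ v₁) ≫ eComp E _ _ _ ≫ eHomWhiskerLeft E x₁ b₁ ⊗ₘ
        (eHomWhiskerLeft E x₂ s₂ ⊗ₘ v₂) ≫ eComp E _ _ _ ≫ eHomWhiskerLeft E x₂ b₂)) ≫
        eTensor x₁ F₁ x₂ F₂ ≫ eHomWhiskerLeft E (x₁ ⊗ x₂) t =
    ((eTensor x₁ A₁ x₂ A₂ ≫ eHomWhiskerLeft E (x₁ ⊗ x₂) μA) ⊗ₘ g) ≫
      (eHomWhiskerLeft E (x₁ ⊗ x₂) s₃ ⊗ₘ v₃) ≫ eComp E _ _ _ ≫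
        eHomWhiskerLeft E (x₁ ⊗ x₂) b₃ := by
  have h1 : box (eHomWhiskerLeft E x₁ s₁) (eHomWhiskerLeft E x₂ s₂) =
    eTensor x₁ A₁ x₂ A₂ ≫ eHomWhiskerLeft E (x₁ ⊗ x₂) (s₁ ⊗ₘ s₂) :=
      eTensor_eHomWhiskerLeft _ _ _ _
  have h2 : ∀ {W X Y Z : C} (f : Y ⟶ Z), eComp E W X Y ≫ eHomWhiskerLeft E W f =
      (W ⟶[E] X) ◁ eHomWhiskerLeft E X f ≫ eComp E W X Z := by
    intro W X Y Z f
    exact eComp_eHomWhiskerLeft _ _ _ _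
  have h3 := comp_middle (eTensor x₁ A₁ x₂ A₂ ≫ eHomWhiskerLeft E (x₁ ⊗ x₂) (s₁ ⊗ₘ s₂)) (g ≫ v₃) μS
  rw [← h, ← h1] at h3
  simp only [← tensorHom_comp_tensorHom, Category.assoc]
  rw [reassoc_of% (eTensor_eHomWhiskerLeft (E := E) x₁ x₂ b₁ b₂), ← eHomWhiskerLeft_comp, hb,
    reassoc_of% (eTensor_comp (E := E) x₁ S₁ N₁ x₂ S₂ N₂), tensorμ_natural_assoc,
    reassoc_of% (tensorμ_tensorμ (x₁ ⟶[E] A₁) (x₂ ⟶[E] A₂) (d₁ ⟶[E] B₁) (d₂ ⟶[E] B₂)),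
    tensorHom_comp_tensorHom_assoc, eHomWhiskerLeft_comp, reassoc_of% (h2 (W := x₁ ⊗ x₂) (X := S₁ ⊗ S₂) μN)]
  have h4 : (eTensor x₁ A₁ x₂ A₂ ≫ eHomWhiskerLeft E (x₁ ⊗ x₂) μA) ≫
      eHomWhiskerLeft E (x₁ ⊗ x₂) s₃ =
      box (eHomWhiskerLeft E x₁ s₁) (eHomWhiskerLeft E x₂ s₂) ≫
        eHomWhiskerLeft E (x₁ ⊗ x₂) μS := by
    rw [h1, Category.assoc, Category.assoc, ← eHomWhiskerLeft_comp, ← eHomWhiskerLeft_comp, hs]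
  rw [tensorHom_comp_tensorHom_assoc, h4, reassoc_of% h3]
  rw [← id_tensorHom, tensorHom_comp_tensorHom_assoc, Category.comp_id]
  rfl

/-- The tensor product of cooperations is compatible with partial compositions. -/
lemma coComp_tensor {n m k : ℕ} (c₁ c₂ : Fin n → C) (i : Fin n) (d₁ d₂ : C) (c₁' c₂' : Fin m → C)
    (e₁ e₂ : Fin k → C) (x₁ x₂ : C) (hd₁ : c₁ i = d₁) (hd₂ : c₂ i = d₂)
    (hd₃ : c₁ i ⊗ c₂ i = d₁ ⊗ d₂) (he₁ : IsGraft c₁ i c₁' e₁) (he₂ : IsGraft c₂ i c₂' e₂)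
    (he₃ : IsGraft (fun j => c₁ j ⊗ c₂ j) i (fun j => c₁' j ⊗ c₂' j) (fun j => e₁ j ⊗ e₂ j)) :
    (tensorμ _ _ _ _ ≫ (coComp E c₁ i d₁ c₁' e₁ x₁ hd₁ he₁ ⊗ₘ coComp E c₂ i d₂ c₂' e₂ x₂ hd₂ he₂)) ≫
        eTensor _ _ _ _ ≫ eHomWhiskerLeft E (x₁ ⊗ x₂) (tupleMu e₁ e₂) =
      ((eTensor _ _ _ _ ≫ eHomWhiskerLeft E (x₁ ⊗ x₂) (tupleMu c₁ c₂)) ⊗ₘ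
          (eTensor _ _ _ _ ≫ eHomWhiskerLeft E (d₁ ⊗ d₂) (tupleMu c₁' c₂'))) ≫
        coComp E (fun j => c₁ j ⊗ c₂ j) i (d₁ ⊗ d₂) (fun j => c₁' j ⊗ c₂' j)
          (fun j => e₁ j ⊗ e₂ j) (x₁ ⊗ x₂) hd₃ he₃ := by
  obtain ⟨zc⟩ := Zip.exists_ofFn c₁ c₂
  obtain ⟨zl⟩ := zc.exists_take i
  obtain ⟨zr⟩ := zc.exists_drop (i + 1)
  obtain ⟨zm⟩ := Zip.exists_ofFn c₁' c₂'
  have h := insertHom_zip zl zr zm d₁ d₂ (eHomWhiskerLeft E d₁ (eqToHom (tensorTuple_eq c₁')))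
    (eHomWhiskerLeft E d₂ (eqToHom (tensorTuple_eq c₂')))
  have hc := tupleMu_zip c₁ c₂ (zl.append (.cons d₁ d₂ zr)) (ofFn_split c₁ i hd₁)
    (ofFn_split c₂ i hd₂) (ofFn_split (fun j => c₁ j ⊗ c₂ j) i hd₃)
  have hm := tupleMu_zip c₁' c₂' zm rfl rfl rfl
  have he := tupleMu_zip e₁ e₂ ((zl.append zm).append zr) he₁ he₂ he₃
  have he' : (graftHom he₁ ⊗ₘ graftHom he₂) ≫ tupleMu e₁ e₂ =
      ((zl.append zm).append zr).mu ≫ graftHom he₃ := by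
    have h1 : (graftHom he₁ ⊗ₘ graftHom he₂) ≫
        (eqToHom ((tensorTuple_eq _).trans (congrArg tensorList he₁)) ⊗ₘ
        eqToHom ((tensorTuple_eq _).trans (congrArg tensorList he₂))) = 𝟙 _ := by
      simp [graftHom]
    have h2 : eqToHom ((tensorTuple_eq _).trans (congrArg tensorList he₃)) ≫ graftHom he₃ = 𝟙 _ := by
      simp [graftHom]
    have h3 := congrArg (fun f => (graftHom he₁ ⊗ₘ graftHom he₂) ≫ f ≫ graftHom he₃) he
    simp only [Category.assoc] at h3
    rw [h2, Category.comp_id, reassoc_of% h1] at h3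
    exact h3
  have hg : eTensor d₁ (tensorTuple c₁') d₂ (tensorTuple c₂') ≫
      eHomWhiskerLeft E (d₁ ⊗ d₂) (tupleMu c₁' c₂') ≫
      eHomWhiskerLeft E (d₁ ⊗ d₂) (eqToHom (tensorTuple_eq (fun j => c₁' j ⊗ c₂' j))) =
      box (eHomWhiskerLeft E d₁ (eqToHom (tensorTuple_eq c₁')))
        (eHomWhiskerLeft E d₂ (eqToHom (tensorTuple_eq c₂'))) ≫ eHomWhiskerLeft E (d₁ ⊗ d₂) zm.mu := by
    rw [box, eTensor_eHomWhiskerLeft, ← eHomWhiskerLeft_comp, Category.assoc,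
      ← eHomWhiskerLeft_comp]
    exact congrArg (fun f => eTensor _ _ _ _ ≫ eHomWhiskerLeft E (d₁ ⊗ d₂) f) hm
  have key := comp_step (E := E) (x₁ := x₁) (x₂ := x₂) (splitHom c₁ i hd₁) (splitHom c₂ i hd₂)
    (eHomWhiskerLeft E d₁ (eqToHom (tensorTuple_eq c₁')) ≫ insertHom E _ d₁ _ _)
    (eHomWhiskerLeft E d₂ (eqToHom (tensorTuple_eq c₂')) ≫ insertHom E _ d₂ _ _)
    (graftHom he₁) (graftHom he₂) (graftHom he₃) (tupleMu e₁ e₂) _ _ he' _ (tupleMu c₁ c₂)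
    (splitHom (fun j => c₁ j ⊗ c₂ j) i hd₃) hc
    (eHomWhiskerLeft E (d₁ ⊗ d₂) (eqToHom (tensorTuple_eq (fun j => c₁' j ⊗ c₂' j))) ≫
      insertHom E _ (d₁ ⊗ d₂) _ _)
    (eTensor _ _ _ _ ≫ eHomWhiskerLeft E (d₁ ⊗ d₂) (tupleMu c₁' c₂'))
    (by
      rw [← hg] at h
      simp only [Category.assoc] at h ⊢
      exact h)
  exact key

variable (E C) in
/-- The operations `C(x; c₀ ⊗ ⋯ ⊗ cₙ₋₁)` of the endomorphism operad of the opposite of the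
symmetric monoidal enriched category `C`. -/
def coEnd : OperadData.{u₂} E where
  Ob := C
  hom c x := x ⟶[E] tensorTuple c
  symm σ c x := eHomWhiskerLeft E x (permHom σ c)
  comp c i d c' e x hd he := coComp E c i d c' e x hd he
  unit x := eHomEquiv E (ρ_ x).inv

lemma rightUnitor_inv_tupleMu (x y : C) :
    ((ρ_ x).inv ⊗ₘ (ρ_ y).inv) ≫ tupleMu (fun _ : Fin 1 => x) (fun _ : Fin 1 => y) =
      (ρ_ (x ⊗ y)).inv := by
  have h : ((ρ_ x).inv ⊗ₘ (ρ_ y).inv) ≫ tensorμ x (𝟙_ C) y (𝟙_ C) ≫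
      (x ⊗ y) ◁ (λ_ (𝟙_ C)).hom = (ρ_ (x ⊗ y)).inv := by
    rw [← Category.assoc, rightUnitor_inv_tensorμ]
    simp
  exact h

lemma coSymm_tensor {n : ℕ} (σ : Equiv.Perm (Fin n)) (c₁ c₂ : Fin n → C) (x₁ x₂ : C) :
    (eHomWhiskerLeft E x₁ (permHom σ c₁) ⊗ₘ eHomWhiskerLeft E x₂ (permHom σ c₂)) ≫
        eTensor _ _ _ _ ≫ eHomWhiskerLeft E (x₁ ⊗ x₂) (tupleMu (c₁ ∘ σ) (c₂ ∘ σ)) =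
      (eTensor _ _ _ _ ≫ eHomWhiskerLeft E (x₁ ⊗ x₂) (tupleMu c₁ c₂)) ≫
        eHomWhiskerLeft E (x₁ ⊗ x₂) (permHom σ (fun j => c₁ j ⊗ c₂ j)) := by
  rw [← Category.assoc, eTensor_eHomWhiskerLeft, Category.assoc, Category.assoc,
    ← eHomWhiskerLeft_comp, permHom_tupleMu, ← eHomWhiskerLeft_comp]

lemma coUnit_tensor (x₁ x₂ : C) :
    ((λ_ (𝟙_ E)).inv ≫ (eHomEquiv E (ρ_ x₁).inv ⊗ₘ eHomEquiv E (ρ_ x₂).inv)) ≫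
        eTensor _ _ _ _ ≫ eHomWhiskerLeft E (x₁ ⊗ x₂)
          (tupleMu (fun _ : Fin 1 => x₁) (fun _ : Fin 1 => x₂)) =
      eHomEquiv E (ρ_ (x₁ ⊗ x₂)).inv := by
  have h := eTensor_homEquiv (E := E) (ρ_ x₁).inv (ρ_ x₂).inv
  have h2 : ∀ {X Y Z : C} (f : X ⟶ Y) (g : Y ⟶ Z),
      eHomEquiv E f ≫ eHomWhiskerLeft E X g = eHomEquiv E (f ≫ g) := by
    intro X Y Z f g
    rw [eHomEquiv_comp, eHomWhiskerLeft, MonoidalCategory.tensorHom_def,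
      rightUnitor_inv_naturality_assoc, unitors_inv_equal, Category.assoc]
  rw [← rightUnitor_inv_tupleMu]
  refine Eq.trans ?_ (h2 ((ρ_ x₁).inv ⊗ₘ (ρ_ x₂).inv)
    (tupleMu (fun _ : Fin 1 => x₁) (fun _ : Fin 1 => x₂)))
  rw [← h]
  simp only [Category.assoc]

variable (E C) in
/-- The tensor product of cooperations: it sends `p : x ⟶ c₀ ⊗ ⋯ ⊗ cₙ₋₁` and
`q : y ⟶ d₀ ⊗ ⋯ ⊗ dₙ₋₁` to `x ⊗ y ⟶ (c₀ ⊗ d₀) ⊗ ⋯ ⊗ (cₙ₋₁ ⊗ dₙ₋₁)`. -/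
def coEndTensor : ((coEnd E C).hadamard (coEnd E C)).Hom (coEnd E C) where
  obj p := MonoidalCategoryStruct.tensorObj (C := C) p.1 p.2
  map c x := eTensor (C := C) x.1 _ x.2 _ ≫ eHomWhiskerLeft (C := C) E
    (MonoidalCategoryStruct.tensorObj (C := C) x.1 x.2)
    (tupleMu (C := C) (Prod.fst ∘ c) (Prod.snd ∘ c))
  map_symm σ c x := coSymm_tensor (C := C) σ (Prod.fst ∘ c) (Prod.snd ∘ c) x.1 x.2
  map_comp c i d c' e x hd he :=
    coComp_tensor (C := C) (Prod.fst ∘ c) (Prod.snd ∘ c) i d.1 d.2 (Prod.fst ∘ c') (Prod.snd ∘ c')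
      (Prod.fst ∘ e) (Prod.snd ∘ e) x.1 x.2 (congrArg Prod.fst hd) (congrArg Prod.snd hd) _
      (he.map Prod.fst) (he.map Prod.snd) _
  map_unit x := coUnit_tensor (C := C) x.1 x.2

end CoEnd

/-- The Hadamard tensor product of morphisms. -/
def OperadData.Hom.hadamard {E : Type u₁} [Category.{v} E] [MonoidalCategory E]
    [SymmetricCategory E] {P : OperadData.{w} E} {P' : OperadData.{w'} E} {Q : OperadData.{w''} E}
    {Q' : OperadData.{w₃} E}
    (f : P.Hom Q) (g : P'.Hom Q') : (P.hadamard P').Hom (Q.hadamard Q') where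
  obj p := (f.obj p.1, g.obj p.2)
  map c x := f.map (Prod.fst ∘ c) x.1 ⊗ₘ g.map (Prod.snd ∘ c) x.2
  map_symm σ c x := by
    refine (tensorHom_comp_tensorHom _ _ _ _).trans
      (Eq.trans ?_ (tensorHom_comp_tensorHom _ _ _ _).symm)
    exact congrArg₂ _ (f.map_symm σ (Prod.fst ∘ c) x.1) (g.map_symm σ (Prod.snd ∘ c) x.2)
  map_comp c i d c' e x hd he := by
    have h₁ := f.map_comp (Prod.fst ∘ c) i d.1 (Prod.fst ∘ c') (Prod.fst ∘ e) x.1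
      (congrArg Prod.fst hd) (he.map Prod.fst)
    have h₂ := g.map_comp (Prod.snd ∘ c) i d.2 (Prod.snd ∘ c') (Prod.snd ∘ e) x.2
      (congrArg Prod.snd hd) (he.map Prod.snd)
    refine (Category.assoc _ _ _).trans (Eq.trans ?_ (had_equi _ _ _ _ _ _ _ _ _ _
      h₁.symm h₂.symm).symm)
    exact (Category.assoc _ _ _).symm
  map_unit x := by
    refine (Category.assoc _ _ _).trans (congrArg _ ?_)
    refine (tensorHom_comp_tensorHom _ _ _ _).trans ?_
    exact congrArg₂ _ (f.map_unit x.1) (g.map_unit x.2)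

variable {E : Type u₁} [Category.{v} E] [MonoidalCategory E] [SymmetricCategory E]

/-- A morphism of enriched operads. -/
abbrev EnrichedOperad.Hom (P : EnrichedOperad.{w} E) (Q : EnrichedOperad.{w'} E) :=
  P.toOperadData.Hom Q.toOperadData

/-- A `P`-coalgebra in the symmetric monoidal enriched category `C`: a morphism of operads from
`P` to the endomorphism operad of `Cᵒᵖ`, that is a family of objects `V x` with structure maps
`P(c₀, …, cₙ₋₁; x) ⟶ C(V x, V c₀ ⊗ ⋯ ⊗ V cₙ₋₁)`. -/
structure Cog (P : EnrichedOperad.{w'} E) (C : Type u₂) [Category.{w} C] [MonoidalCategory C]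
    [SymmetricCategory C] [EnrichedOrdinaryCategory E C]
    [SymmetricMonoidalEnrichedCategory E C] where
  /-- the structural morphism of operads -/
  str : P.toOperadData.Hom (coEnd E C)

namespace Cog

variable {C : Type u₂} [Category.{w} C] [MonoidalCategory C] [SymmetricCategory C]
  [EnrichedOrdinaryCategory E C] [SymmetricMonoidalEnrichedCategory E C]

section

variable {P : EnrichedOperad.{w'} E}

/-- The object of colour `x` of a coalgebra. -/
def X (V : Cog P C) (x : P.Ob) : C := V.str.obj x

/-- The cooperations of a coalgebra. -/
def coop (V : Cog P C) {n : ℕ} (c : Fin n → P.Ob) (x : P.Ob) :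
    P.hom c x ⟶ (V.X x ⟶[E] tensorTuple (fun i => V.X (c i))) := V.str.map c x

/-- A morphism of coalgebras: a family of morphisms commuting with all cooperations. -/
@[ext]
structure Hom (V W : Cog P C) where
  /-- the components -/
  app (x : P.Ob) : V.X x ⟶ W.X x
  comm {n : ℕ} (c : Fin n → P.Ob) (x : P.Ob) :
    V.coop c x ≫ eHomWhiskerLeft E (V.X x) (tensorTupleMap (fun i => app (c i))) =
      W.coop c x ≫ eHomWhiskerRight E (app x) (tensorTuple (fun i => W.X (c i)))

instance : Category (Cog P C) where
  Hom V W := Hom V W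
  id V :=
    { app := fun x => 𝟙 (V.X x)
      comm := fun c x => by simp }
  comp {V W U} f g :=
    { app := fun x => f.app x ≫ g.app x
      comm := fun c x => by
        rw [tensorTupleMap_comp]
        exact Sq.trans (f.comm c x) (g.comm c x) }
  id_comp f := Hom.ext (funext fun x => Category.id_comp _)
  comp_id f := Hom.ext (funext fun x => Category.comp_id _)
  assoc f g h := Hom.ext (funext fun x => Category.assoc _ _ _)

variable (P C) in
/-- The forgetful functor `Cog(P) ⥤ C^Ob(P)`. -/
def forget : Cog P C ⥤ (P.Ob → C) where
  obj V := V.X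
  map f := f.app

end

/-- The functor `f^* : Cog(P') ⥤ Cog(P)` of restriction along `f : P ⟶ P'`. -/
def restrict {P P' : EnrichedOperad.{w'} E} (f : P.Hom P') : Cog P' C ⥤ Cog P C where
  obj V := ⟨f.trans V.str⟩
  map {V W} g :=
    { app := fun x => g.app (f.obj x)
      comm := fun c x => Sq.pre (g.comm (f.obj ∘ c) (f.obj x)) (f.map c x) }

/-- The tensor product `V ◊ W` of a `P`-coalgebra and a `Q`-coalgebra: its object of colour
`(x, y)` is `V x ⊗ W y`. -/
def lozengeObj {P : EnrichedOperad.{w'} E} {Q : EnrichedOperad.{w''} E} (V : Cog P C)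
    (W : Cog Q C) : Cog (P.hadamard Q) C :=
  ⟨(V.str.hadamard W.str).trans (coEndTensor E C)⟩

lemma lozengeObj_X {P : EnrichedOperad.{w'} E} {Q : EnrichedOperad.{w''} E} (V : Cog P C)
    (W : Cog Q C) (x : P.Ob × Q.Ob) : (lozengeObj V W).X x = V.X x.1 ⊗ W.X x.2 := rfl

lemma lozengeObj_coop {P : EnrichedOperad.{w'} E} {Q : EnrichedOperad.{w''} E} (V : Cog P C)
    (W : Cog Q C) {n : ℕ} (c : Fin n → P.Ob × Q.Ob) (x : P.Ob × Q.Ob) :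
    (lozengeObj V W).coop c x = box (V.coop (Prod.fst ∘ c) x.1) (W.coop (Prod.snd ∘ c) x.2) ≫
      eHomWhiskerLeft E (V.X x.1 ⊗ W.X x.2)
        (tupleMu (fun i => V.X (c i).1) (fun i => W.X (c i).2)) :=
  (Category.assoc _ _ _).symm

lemma lozenge_comm {P : EnrichedOperad.{w'} E} {Q : EnrichedOperad.{w''} E} {V V' : Cog P C}
    {W W' : Cog Q C} (f : Hom V V') (g : Hom W W') {n : ℕ} (c : Fin n → P.Ob × Q.Ob)
    (x : P.Ob × Q.Ob) :
    Sq ((lozengeObj V W).coop c x) ((lozengeObj V' W').coop c x) (f.app x.1 ⊗ₘ g.app x.2)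
      (tensorTupleMap (fun i => f.app (c i).1 ⊗ₘ g.app (c i).2)) := by
  rw [lozengeObj_coop, lozengeObj_coop]
  exact Sq.post (Sq.tensor (f.comm (Prod.fst ∘ c) x.1) (g.comm (Prod.snd ∘ c) x.2)) _ _ _
    (tupleMu_natural (fun i => f.app (c i).1) (fun i => g.app (c i).2)).symm

/-- The bifunctor `(V, W) ↦ V ◊ W`. -/
def lozenge (P : EnrichedOperad.{w'} E) (Q : EnrichedOperad.{w''} E) :
    Cog P C ⥤ Cog Q C ⥤ Cog (P.hadamard Q) C where
  obj V :=
    { obj := fun W => lozengeObj V W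
      map := fun {W W'} g =>
        { app := fun x => 𝟙 (V.X x.1) ⊗ₘ g.app x.2
          comm := fun c x => lozenge_comm (𝟙 V) g c x }
      map_id := fun W => Hom.ext (funext fun x => id_tensorHom_id _ _)
      map_comp := fun g g' => Hom.ext (funext fun x => by
        refine Eq.trans ?_ (tensorHom_comp_tensorHom _ _ _ _).symm
        exact congrArg (fun a => a ⊗ₘ (g.app x.2 ≫ g'.app x.2)) (Category.comp_id _).symm) }
  map {V V'} f :=
    { app := fun W =>
        { app := fun x => f.app x.1 ⊗ₘ 𝟙 (W.X x.2)
          comm := fun c x => lozenge_comm f (𝟙 W) c x }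
      naturality := fun W W' g => Hom.ext (funext fun x => by
        refine (tensorHom_comp_tensorHom _ _ _ _).trans
          (Eq.trans ?_ (tensorHom_comp_tensorHom _ _ _ _).symm)
        exact congrArg₂ (fun a b => a ⊗ₘ b)
          ((Category.id_comp (f.app x.1)).trans (Category.comp_id (f.app x.1)).symm)
          ((Category.comp_id (g.app x.2)).trans (Category.id_comp (g.app x.2)).symm)) }
  map_id V := by
    refine NatTrans.ext (funext fun W => Hom.ext (funext fun x => id_tensorHom_id _ _))
  map_comp f f' := by
    refine NatTrans.ext (funext fun W => Hom.ext (funext fun x => ?_))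
    refine Eq.trans ?_ (tensorHom_comp_tensorHom _ _ _ _).symm
    exact congrArg (fun a => (f.app x.1 ≫ f'.app x.1) ⊗ₘ a) (Category.comp_id _).symm

end Cog

end Coalgebras

end EnrichedOperads

/-!
Both parts come from the adjoint lifting theorem for comonadic functors: in a square of functors
`U ⋙ L ≅ Q ⋙ V` with `V` comonadic, `U` a left adjoint and coreflexive equalisers in the domain
of `Q`, the functor `Q` has a right adjoint as soon as `L` has one
(`isLeftAdjoint_square_lift_comonadic`).

The functors `- ◊ V₁`, `V₀ ◊ -` and `f^*` lie, along the forgetful functors, over functors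
`C^I ⥤ C^J` of the form `X ↦ (j ↦ L j (X (f j)))` (`reindex`), where `L j` is `- ⊗ V₁`, `V₀ ⊗ -`
in the appropriate colour, or the identity. Such a functor has a right adjoint when every `L j`
has one: it is the product over the fibres of `f` of the right adjoints
(`reindex_isLeftAdjoint`).

For `f^*`, a comonadic functor creates coreflexive equalisers when its comonad preserves them
(`createsCoreflexiveEqualizer`), which provides coreflexive equalisers in `Cog(P')`, shows that
`U_{P'}` preserves them and that `U_P` reflects them. As equalisers in powers of `C` are computed
pointwise, `f^*` preserves coreflexive equalisers. When `f` is surjective on colours, `f^*` also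
reflects isomorphisms, since a morphism of coalgebras is invertible as soon as all its components
are; the crude comonadicity theorem concludes.
-/

/-! ### Functors between powers of a category -/

namespace EnrichedOperads

section Powers

universe v₁ v₂ v₃ u₃

variable {C : Type u₁} [Category.{v₁} C] {D : Type u₂} [Category.{v₂} D] {I J : Type w}

/-- The functor `C^I ⥤ D^J` sending `X` to the family `L j (X (f j))`. -/
def reindex (f : J → I) (L : J → C ⥤ D) : (I → C) ⥤ (J → D) where
  obj X j := (L j).obj (X (f j))
  map g j := (L j).map (g (f j))

/-- The right adjoint sends `Y` to the family of products over the fibres of `f`,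
`i ↦ ∏ (R j) (Y j)`, where `R j` is the right adjoint of `L j`. -/
lemma reindex_isLeftAdjoint [HasProducts.{w} C] (f : J → I) (L : J → C ⥤ D)
    [∀ j, (L j).IsLeftAdjoint] : (reindex f L).IsLeftAdjoint := by
  let adj j := Adjunction.ofIsLeftAdjoint (L j)
  let e (X : I → C) (Y : J → D) : ((reindex f L).obj X ⟶ Y) ≃
      (X ⟶ fun i => ∏ᶜ fun j : {j // f j = i} => (L j).rightAdjoint.obj (Y j)) :=
    -- an index `j` in the fibre over `i` has `f j = i` only propositionally, hence the `eqToHom`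
    { toFun := fun g i => Pi.lift fun j =>
        eqToHom (congrArg X j.2.symm) ≫ (adj j).homEquiv _ _ (g j)
      invFun := fun h j => ((adj j).homEquiv _ _).symm (h (f j) ≫
        Pi.π (fun j' : {j' // f j' = f j} => (L j').rightAdjoint.obj (Y j')) ⟨j, rfl⟩)
      left_inv := fun g => by
        funext j
        simp only [limit.lift_π, Fan.mk_π_app, eqToHom_refl, Category.id_comp]
        exact ((adj j).homEquiv _ _).symm_apply_apply (g j)
      right_inv := fun h => by
        funext i
        refine Pi.hom_ext _ _ fun ⟨j, hj⟩ => ?_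
        subst hj
        simp }
  have he (X : I → C) (Y : J → D) (g : (reindex f L).obj X ⟶ Y) (j : J) :
      e X Y g (f j) ≫ Pi.π (fun j' : {j' // f j' = f j} => (L j').rightAdjoint.obj (Y j'))
        ⟨j, rfl⟩ = (adj j).homEquiv _ _ (g j) :=
    (Pi.lift_π _ _).trans (Category.id_comp _)
  refine (Adjunction.adjunctionOfEquivRight e fun X' X Y g h => ?_).isLeftAdjoint
  funext i
  refine Pi.hom_ext _ _ fun ⟨j, hj⟩ => ?_
  subst hj
  rw [he]
  refine ((adj j).homEquiv_naturality_left (g (f j)) (h j)).trans ?_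
  rw [← he]
  exact (Category.assoc _ _ _).symm

lemma isIso_of_isIso_apply {X Y : I → C} (g : X ⟶ Y) (h : ∀ i, IsIso (g i)) : IsIso g :=
  (Pi.isoMk fun i => asIso (g i)).isIso_hom

lemma isIso_apply {X Y : I → C} (g : X ⟶ Y) [IsIso g] (i : I) : IsIso (g i) :=
  inferInstanceAs (IsIso ((Pi.eval (fun _ => C) i).map g))

section Limits

variable {K : Type u₃} [Category.{v₃} K] [HasLimitsOfShape K C]

/-- The cone over a diagram in `C^I` which is pointwise a limit cone. -/
noncomputable def pointwiseCone (G : K ⥤ (I → C)) : Cone G where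
  pt i := limit (G ⋙ Pi.eval _ i)
  π :=
    { app := fun k i => limit.π (G ⋙ Pi.eval _ i) k
      naturality := fun _ _ g => by
        funext i
        exact (Category.id_comp _).trans (limit.w (G ⋙ Pi.eval _ i) g).symm }

/-- A cone in a power of `D` is a limit cone if it is so in each coordinate. -/
def isLimitOfEval {G : K ⥤ (I → D)} (c : Cone G)
    (h : ∀ i, IsLimit ((Pi.eval (fun _ => D) i).mapCone c)) : IsLimit c where
  lift s i := (h i).lift ((Pi.eval _ i).mapCone s)
  fac s k := by
    funext i
    exact (h i).fac ((Pi.eval _ i).mapCone s) k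
  uniq s m hm := by
    funext i
    exact (h i).uniq ((Pi.eval _ i).mapCone s) (m i) fun k => congrFun (hm k) i

/-- The pointwise limit cone is a limit cone. -/
noncomputable def pointwiseConeIsLimit (G : K ⥤ (I → C)) : IsLimit (pointwiseCone G) :=
  isLimitOfEval _ fun i => (limit.isLimit (G ⋙ Pi.eval _ i)).ofIsoLimit
    (Cone.ext (Iso.refl _) fun _ => (Category.id_comp _).symm)

variable (K C I) in
lemma hasLimitsOfShape_powers : HasLimitsOfShape K (I → C) :=
  ⟨fun G => ⟨⟨⟨_, pointwiseConeIsLimit G⟩⟩⟩⟩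

variable (K) in
lemma preservesLimitsOfShape_reindex (f : J → I) (L : J → C ⥤ D)
    [∀ j, PreservesLimitsOfShape K (L j)] : PreservesLimitsOfShape K (reindex f L) where
  preservesLimit {G} :=
    preservesLimit_of_preserves_limit_cone (pointwiseConeIsLimit G) <|
      isLimitOfEval _ fun j =>
        (isLimitOfPreserves (L j) (limit.isLimit (G ⋙ Pi.eval _ (f j)))).ofIsoLimit
          (Cone.ext (Iso.refl _) fun _ => (Category.id_comp _).symm)

end Limits

end Powers

/-! ### Coreflexive equalisers and comonadic functors -/

section Comonadic

universe v₁

variable {C : Type u₁} [Category.{v₁} C] {D : Type u₂} [Category.{v₁} D]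

lemma isCoreflexivePair_map (F : C ⥤ D) {A B : C} (f g : A ⟶ B) [IsCoreflexivePair f g] :
    IsCoreflexivePair (F.map f) (F.map g) :=
  IsCoreflexivePair.mk' (F.map (commonRetraction f g))
    (by rw [← F.map_comp, left_comp_retraction, F.map_id])
    (by rw [← F.map_comp, right_comp_retraction, F.map_id])

/-- `parallelPair f g ⋙ F` is again, up to isomorphism, a coreflexive pair. -/
lemma preservesLimit_parallelPair_comp (T : D ⥤ D) [Comonad.PreservesLimitOfIsCoreflexivePair T]
    (F : C ⥤ D) {A B : C} (f g : A ⟶ B) [IsCoreflexivePair f g] :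
    PreservesLimit (parallelPair f g ⋙ F) T :=
  have := isCoreflexivePair_map F f g
  preservesLimit_of_iso_diagram T (K₁ := parallelPair (F.map f) (F.map g))
    (diagramIsoParallelPair (parallelPair f g ⋙ F)).symm

lemma reflectsIsomorphisms_of_comonadic (F : C ⥤ D) [ComonadicLeftAdjoint F] :
    F.ReflectsIsomorphisms :=
  reflectsIsomorphisms_of_iso (Comonad.comparisonForget (comonadicAdjunction F))

variable (F : C ⥤ D) [ComonadicLeftAdjoint F]
  [Comonad.PreservesLimitOfIsCoreflexivePair (comonadicAdjunction F).toComonad.toFunctor]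

/-- A comonadic functor creates coreflexive equalisers as soon as its comonad preserves them. -/
noncomputable abbrev createsCoreflexiveEqualizer {A B : C} (f g : A ⟶ B) [IsCoreflexivePair f g] :
    CreatesLimit (parallelPair f g) F :=
  letI T : D ⥤ D := comonadicRightAdjoint F ⋙ F
  haveI : Comonad.PreservesLimitOfIsCoreflexivePair T :=
    inferInstanceAs (Comonad.PreservesLimitOfIsCoreflexivePair
      (comonadicAdjunction F).toComonad.toFunctor)
  -- lifting a limit of `K ⋙ F` along `F` needs `T` to preserve limits of `K ⋙ F` and `K ⋙ F ⋙ T`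
  haveI : PreservesLimit (parallelPair f g ⋙ F) (comonadicRightAdjoint F ⋙ F) :=
    preservesLimit_parallelPair_comp T F f g
  haveI : PreservesLimit ((parallelPair f g ⋙ F) ⋙ comonadicRightAdjoint F ⋙ F)
      (comonadicRightAdjoint F ⋙ F) :=
    preservesLimit_parallelPair_comp T (F ⋙ T) f g
  comonadicCreatesLimitOfPreservesLimit F (parallelPair f g)

lemma hasCoreflexiveEqualizers_of_comonadic (F : C ⥤ D) [ComonadicLeftAdjoint F]
    [Comonad.PreservesLimitOfIsCoreflexivePair (comonadicAdjunction F).toComonad.toFunctor]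
    [HasEqualizers D] : HasCoreflexiveEqualizers C where
  has_eq _ _ f g _ :=
    letI := createsCoreflexiveEqualizer F f g
    hasLimit_of_created (parallelPair f g) F

lemma preservesCoreflexiveEqualizers_of_comonadic [HasEqualizers D] :
    Comonad.PreservesLimitOfIsCoreflexivePair F where
  out _ _ f g _ :=
    letI := createsCoreflexiveEqualizer F f g
    inferInstance

end Comonadic

/-! ### Coalgebras over enriched operads -/

section Coalgebras

variable {E : Type u₁} [Category.{v} E] [MonoidalCategory E] [SymmetricCategory E]
  {C : Type u₂} [Category.{v} C] [MonoidalCategory C] [SymmetricCategory C]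
  [EnrichedOrdinaryCategory E C] [SymmetricMonoidalEnrichedCategory E C]

namespace Cog

/-- The functor `- ◊ V₁` lies over `X ↦ ((o, o') ↦ X o ⊗ V₁ o')`. -/
lemma lozenge_flip_obj_isLeftAdjoint {P₀ P₁ : EnrichedOperad.{w} E} [MonoidalClosed C]
    [HasProducts.{w} C] [ComonadicLeftAdjoint (forget C P₀)]
    [ComonadicLeftAdjoint (forget C (P₀.hadamard P₁))] [HasCoreflexiveEqualizers (Cog P₀ C)]
    (V₁ : Cog P₁ C) : ((lozenge P₀ P₁).flip.obj V₁).IsLeftAdjoint := by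
  let L : (P₀.hadamard P₁).Ob → C ⥤ C := fun x => tensorRight (V₁.X x.2)
  have (x : (P₀.hadamard P₁).Ob) : (L x).IsLeftAdjoint :=
    ((ihom.adjunction (V₁.X x.2)).ofNatIsoLeft
      (BraidedCategory.tensorLeftIsoTensorRight _)).isLeftAdjoint
  have := reindex_isLeftAdjoint (fun x : (P₀.hadamard P₁).Ob => x.1) L
  exact isLeftAdjoint_square_lift_comonadic _ (forget C (P₀.hadamard P₁)) (forget C P₀)
    (reindex (fun x : (P₀.hadamard P₁).Ob => x.1) L)
    (NatIso.ofComponents (fun V => Iso.refl _) fun f => by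
      refine (Category.comp_id _).trans (Eq.trans ?_ (Category.id_comp _).symm)
      funext x
      exact (tensorHom_id _ _).symm)

/-- The functor `V₀ ◊ -` lies over `X ↦ ((o, o') ↦ V₀ o ⊗ X o')`. -/
lemma lozenge_obj_isLeftAdjoint {P₀ P₁ : EnrichedOperad.{w} E} [MonoidalClosed C]
    [HasProducts.{w} C] [ComonadicLeftAdjoint (forget C P₁)]
    [ComonadicLeftAdjoint (forget C (P₀.hadamard P₁))] [HasCoreflexiveEqualizers (Cog P₁ C)]
    (V₀ : Cog P₀ C) : ((lozenge P₀ P₁).obj V₀).IsLeftAdjoint := by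
  let L : (P₀.hadamard P₁).Ob → C ⥤ C := fun x => tensorLeft (V₀.X x.1)
  have (x : (P₀.hadamard P₁).Ob) : (L x).IsLeftAdjoint :=
    (ihom.adjunction (V₀.X x.1)).isLeftAdjoint
  have := reindex_isLeftAdjoint (fun x : (P₀.hadamard P₁).Ob => x.2) L
  exact isLeftAdjoint_square_lift_comonadic _ (forget C (P₀.hadamard P₁)) (forget C P₁)
    (reindex (fun x : (P₀.hadamard P₁).Ob => x.2) L)
    (NatIso.ofComponents (fun V => Iso.refl _) fun f => by
      refine (Category.comp_id _).trans (Eq.trans ?_ (Category.id_comp _).symm)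
      funext x
      exact (id_tensorHom _ _).symm)

variable {P P' : EnrichedOperad.{w} E} (f : P.Hom P')

/-- Restriction along `f` lies over the reindexing functor along the map of colours of `f`. -/
def restrictForgetIso :
    forget C P' ⋙ reindex f.obj (fun _ => 𝟭 C) ≅ restrict f ⋙ forget C P :=
  Iso.refl _

lemma restrict_isLeftAdjoint [HasProducts.{w} C] [ComonadicLeftAdjoint (forget C P)]
    [ComonadicLeftAdjoint (forget C P')] [HasCoreflexiveEqualizers (Cog P' C)] :
    (restrict (C := C) f).IsLeftAdjoint :=
  have : (reindex f.obj fun _ => 𝟭 C).IsLeftAdjoint := reindex_isLeftAdjoint _ _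
  isLeftAdjoint_square_lift_comonadic _ (forget C P) (forget C P') _ (restrictForgetIso f)

lemma restrict_reflectsIsomorphisms [ComonadicLeftAdjoint (forget C P')]
    (hf : Function.Surjective f.obj) : (restrict (C := C) f).ReflectsIsomorphisms where
  reflects {V W} g _ := by
    have (y : P'.Ob) : IsIso (((forget C P').map g) y) := by
      -- the component of `g` at the colour `f x` is the component of `f^* g` at `x`
      obtain ⟨x, rfl⟩ := hf y
      exact isIso_apply ((forget C P).map ((restrict f).map g)) x
    have := isIso_of_isIso_apply ((forget C P').map g) this
    have := reflectsIsomorphisms_of_comonadic (forget C P')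
    exact isIso_of_reflects_iso g (forget C P')

lemma restrict_preservesCoreflexiveEqualizers [HasEqualizers C]
    [ComonadicLeftAdjoint (forget C P)] [ComonadicLeftAdjoint (forget C P')]
    [Comonad.PreservesLimitOfIsCoreflexivePair
      (comonadicAdjunction (forget C P)).toComonad.toFunctor]
    [Comonad.PreservesLimitOfIsCoreflexivePair
      (comonadicAdjunction (forget C P')).toComonad.toFunctor] :
    Comonad.PreservesLimitOfIsCoreflexivePair (restrict (C := C) f) where
  out A B a b _ := by
    have : HasEqualizers (P'.Ob → C) := hasLimitsOfShape_powers _ _ _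
    have := preservesCoreflexiveEqualizers_of_comonadic (forget C P')
    have := preservesLimitsOfShape_reindex WalkingParallelPair f.obj (fun _ => 𝟭 C)
    have : PreservesLimit (parallelPair a b) (restrict f ⋙ forget C P) :=
      preservesLimit_of_natIso _ (restrictForgetIso f)
    have := isCoreflexivePair_map (restrict (C := C) f) a b
    let := createsCoreflexiveEqualizer (forget C P)
      ((restrict (C := C) f).map a) ((restrict (C := C) f).map b)
    have : ReflectsLimit (parallelPair a b ⋙ restrict f) (forget C P) :=
      reflectsLimit_of_iso_diagram
        (K₁ := parallelPair ((restrict (C := C) f).map a) ((restrict (C := C) f).map b)) _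
        (diagramIsoParallelPair (parallelPair a b ⋙ restrict f)).symm
    exact preservesLimit_of_reflects_of_preserves (restrict f) (forget C P)

end Cog

end Coalgebras

end EnrichedOperads

theorem mainTheorem8
    {E : Type u₁} [Category.{v} E] [MonoidalCategory E] [SymmetricCategory E]
    {C : Type u₂} [Category.{v} C] [MonoidalCategory C] [SymmetricCategory C]
    [EnrichedOrdinaryCategory E C]
    [EnrichedOperads.SymmetricMonoidalEnrichedCategory E C] :
    (∀ P₀ P₁ : EnrichedOperads.EnrichedOperad.{w} E,
      Nonempty (MonoidalClosed C) → HasProducts.{w} C →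
      Nonempty (ComonadicLeftAdjoint (EnrichedOperads.Cog.forget C (P₀.hadamard P₁))) →
      ((Nonempty (ComonadicLeftAdjoint (EnrichedOperads.Cog.forget C P₀)) →
          HasCoreflexiveEqualizers (EnrichedOperads.Cog P₀ C) →
          ∀ V₁ : EnrichedOperads.Cog P₁ C,
            ((EnrichedOperads.Cog.lozenge P₀ P₁).flip.obj V₁).IsLeftAdjoint) ∧
        (Nonempty (ComonadicLeftAdjoint (EnrichedOperads.Cog.forget C P₁)) →
          HasCoreflexiveEqualizers (EnrichedOperads.Cog P₁ C) →
          ∀ V₀ : EnrichedOperads.Cog P₀ C,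
            ((EnrichedOperads.Cog.lozenge P₀ P₁).obj V₀).IsLeftAdjoint))) ∧
    (∀ (P P' : EnrichedOperads.EnrichedOperad.{w} E) (f : P.Hom P')
      [HasLimitsOfSize.{w, w} C]
      [ComonadicLeftAdjoint (EnrichedOperads.Cog.forget C P)]
      [ComonadicLeftAdjoint (EnrichedOperads.Cog.forget C P')],
      Comonad.PreservesLimitOfIsCoreflexivePair
        (comonadicAdjunction (EnrichedOperads.Cog.forget C P)).toComonad.toFunctor →
      Comonad.PreservesLimitOfIsCoreflexivePair
        (comonadicAdjunction (EnrichedOperads.Cog.forget C P')).toComonad.toFunctor →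
      (EnrichedOperads.Cog.restrict (C := C) f).IsLeftAdjoint ∧
        (Function.Surjective f.obj →
          Nonempty (ComonadicLeftAdjoint (EnrichedOperads.Cog.restrict (C := C) f)))) := by
  refine ⟨fun P₀ P₁ ⟨_⟩ _ ⟨_⟩ => ⟨fun ⟨_⟩ _ =>
      EnrichedOperads.Cog.lozenge_flip_obj_isLeftAdjoint,
    fun ⟨_⟩ _ => EnrichedOperads.Cog.lozenge_obj_isLeftAdjoint⟩, fun P P' f _ _ _ hT hT' => ?_⟩
  have : HasFiniteLimits C := hasFiniteLimits_of_hasLimitsOfSize C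
  have : HasEqualizers (P'.Ob → C) := EnrichedOperads.hasLimitsOfShape_powers _ _ _
  have := EnrichedOperads.hasCoreflexiveEqualizers_of_comonadic (EnrichedOperads.Cog.forget C P')
  have : HasProducts.{w} C := fun _ => inferInstance
  have h := EnrichedOperads.Cog.restrict_isLeftAdjoint (C := C) f
  refine ⟨h, fun hf => ?_⟩
  have := EnrichedOperads.Cog.restrict_reflectsIsomorphisms (C := C) f hf
  have := EnrichedOperads.Cog.restrict_preservesCoreflexiveEqualizers (C := C) f
  exact ⟨Comonad.comonadicOfHasPreservesCoreflexiveEqualizersOfReflectsIsomorphisms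
    (Adjunction.ofIsLeftAdjoint (EnrichedOperads.Cog.restrict f))⟩
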